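/- Let $\mathbb{K}$ be an algebraically closed field of characteristic zero and let $\mathbb{F}$ be the algebraic closure of $\mathbb{K}(x_1,\ldots,x_4,y_1,\ldots,y_4)$. Write every rational map between projective spaces over $\mathbb{K}$ as a tuple of forms of the same degree without common factor; this degree is the degree of the map, and its base locus $\mathscr{B}(\cdot)$ is the set of common zeros of the forms. Let $\mathscr{S}\subset\mathbb{P}^3(\mathbb{K})$ be an irreducible surface, $\mathcal{Q}:\mathbb{P}^2(\mathbb{K})\dashrightarrow\mathscr{S}$ a birational parametrization with $\mathscr{B}(\mathcal{Q})=\emptyset$, $\mathcal{S}=(s_1:s_2:s_3):\mathbb{P}^2(\mathbb{K})\dashrightarrow\mathbb{P}^2(\mathbb{K})$ a rational map, and $\mathcal{P}=(p_1:\cdots:p_4):\mathbb{P}^2(\mathbb{K})\dashrightarrow\mathbb{P}^3(\mathbb{K})$ the rational map $\mathcal{P}=\mathcal{Q}\circ\mathcal{S}$ (for instance, $\mathcal{P}$ any other birational parametrization of $\mathscr{S}$ and $\mathcal{S}=\mathcal{Q}^{-1}\circ\mathcal{P}$). Over $\mathbb{F}$ consider the plane curves $\mathscr{C}(W_1),\mathscr{C}(W_2),\mathscr{C}(V_1),\mathscr{C}(V_2)$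 defined by $$W_1=\sum_{i=1}^4 x_i p_i,\quad W_2=\sum_{i=1}^4 y_i p_i,\quad V_1=\sum_{i=1}^3 x_i s_i,\quad V_2=\sum_{i=1}^3 y_i s_i .$$ For a point $A$ let $\mathrm{mult}(A,\mathscr{C})$ be the multiplicity of the curve $\mathscr{C}$ at $A$, and let $\mathrm{mult}(A,\mathscr{B}(\mathcal{S}))$ and $\mathrm{mult}(A,\mathscr{B}(\mathcal{P}))$ be the intersection multiplicities at $A$ of $\mathscr{C}(V_1),\mathscr{C}(V_2)$ and of $\mathscr{C}(W_1),\mathscr{C}(W_2)$, respectively. Then $\mathscr{B}(\mathcal{S})=\mathscr{B}(\mathcal{P})$, and for every $A\in\mathscr{B}(\mathcal{S})$: $$\mathrm{mult}(A,\mathscr{C}(W_1))=\mathrm{mult}(A,\mathscr{C}(V_1))\cdot\deg(\mathcal{Q}),$$ the number $\mathrm{mult}(A,\mathscr{B}(\mathcal{S}))$ is finite, and $$\deg(\mathscr{S})\cdot\mathrm{mult}(A,\mathscr{B}(\mathcal{S}))=\mathrm{mult}(A,\mathscr{B}(\mathcal{P})),$$ where $\deg(\mathscr{S})$ is the degree of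 the surface $\mathscr{S}$. -/

import Mathlib

open MvPolynomial
open scoped LinearAlgebra.Projectivization

/-- A rational map from projective `(n-1)`-space to projective `(m-1)`-space over `K`, written in
lowest terms: forms of one common degree without a common non-constant factor
(in particular they are not all zero). -/
structure ProjRatMap (K : Type*) [Field K] (n m : ℕ) where
  coords : Fin m → MvPolynomial (Fin n) K
  degree : ℕ
  homogeneous : ∀ i, (coords i).IsHomogeneous degree
  coprime : ∀ h : MvPolynomial (Fin n) K, (∀ i, h ∣ coords i) → IsUnit h

/-- An irreducible projective surface in projective 3-space, given by its defining form. -/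
structure ProjSurface (K : Type*) [Field K] where
  form : MvPolynomial (Fin 4) K
  irreducible : Irreducible form
  homogeneous : form.IsHomogeneous form.totalDegree

namespace ProjSurface

/-- The degree of the surface is the degree of its irreducible defining form. -/
noncomputable def degree {K : Type*} [Field K] (T : ProjSurface K) : ℕ := T.form.totalDegree

end ProjSurface

namespace ProjRatMap

/-- The base points: the common zeros of the coordinate forms. -/
def baseLocus {K : Type*} [Field K] {n m : ℕ} (f : ProjRatMap K n m) :
    Set (ℙ K (Fin n → K)) :=
  {A | ∀ i, eval A.rep (f.coords i) = 0}

/-- `g ∘ f = h` as rational maps: the composite is defined (the forms `g (f t)` do not all vanish)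
and the tuples `g (f t)` and `h t` are proportional. -/
def CompEq {K : Type*} [Field K] {n m l : ℕ} (g : ProjRatMap K m l) (f : ProjRatMap K n m)
    (h : ProjRatMap K n l) : Prop :=
  (∃ i, bind₁ f.coords (g.coords i) ≠ 0) ∧
    ∀ i j, bind₁ f.coords (g.coords i) * h.coords j = bind₁ f.coords (g.coords j) * h.coords i

/-- `Q` is a birational parametrization of the surface `T`: it maps into `T` and there is a rational
map `R` from `T` to the plane, given by forms of one common degree, such that `R ∘ Q` is defined and
is the identity of the plane, and `Q ∘ R` is defined and is the identity of `T` (a form vanishes on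
`T` when it is divisible by the defining form of `T`). -/
def IsBirationalOnto {K : Type*} [Field K] (Q : ProjRatMap K 3 4) (T : ProjSurface K) : Prop :=
  bind₁ Q.coords T.form = 0 ∧
    ∃ (R : Fin 3 → MvPolynomial (Fin 4) K) (e : ℕ),
      (∀ i, (R i).IsHomogeneous e) ∧
      (∃ i, bind₁ Q.coords (R i) ≠ 0) ∧
      (∀ i j, bind₁ Q.coords (R i) * X j = bind₁ Q.coords (R j) * X i) ∧
      (∃ i, ¬ T.form ∣ bind₁ R (Q.coords i)) ∧
      (∀ i j, T.form ∣ bind₁ R (Q.coords i) * X j - bind₁ R (Q.coords j) * X i)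

end ProjRatMap

namespace PlaneCurve

variable {L : Type*} [Field L]

theorem exists_rep_ne_zero (A : ℙ L (Fin 3 → L)) : ∃ k, A.rep k ≠ 0 :=
  Function.ne_iff.mp A.rep_nonzero

/-- The index of a standard affine chart of the plane containing `A`. -/
noncomputable def chart (A : ℙ L (Fin 3 → L)) : Fin 3 := (exists_rep_ne_zero A).choose

theorem chart_spec (A : ℙ L (Fin 3 → L)) : A.rep (chart A) ≠ 0 :=
  (exists_rep_ne_zero A).choose_spec

/-- The local equation at `A` of the curve `f = 0`: dehomogenize in a standard chart containing `A`
and translate `A` to the origin. -/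
noncomputable def localEq (A : ℙ L (Fin 3 → L)) (f : MvPolynomial (Fin 3) L) :
    MvPolynomial (Fin 2) L :=
  aeval (Fin.insertNth (α := fun _ => MvPolynomial (Fin 2) L) (chart A) 1
    (fun j => X j + C (A.rep ((chart A).succAbove j) / A.rep (chart A)))) f

/-- The multiplicity at `A` of the curve `f = 0`: the lowest degree of a monomial in the local
equation at `A`. -/
noncomputable def mult (A : ℙ L (Fin 3 → L)) (f : MvPolynomial (Fin 3) L) : ℕ∞ :=
  MvPowerSeries.order (localEq A f : MvPowerSeries (Fin 2) L)

variable (L) in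
/-- The maximal ideal of the origin of the affine plane. -/
noncomputable def originIdeal : Ideal (MvPolynomial (Fin 2) L) :=
  RingHom.ker (constantCoeff : MvPolynomial (Fin 2) L →+* L)

instance originIdeal_isPrime : (originIdeal L).IsPrime :=
  RingHom.ker_isPrime _

variable (L) in
/-- The local ring of the affine plane at the origin. -/
abbrev LocalRing : Type _ := Localization.AtPrime (originIdeal L)

/-- The intersection multiplicity at `A` of the curves `f = 0` and `g = 0`: the dimension over `L`
of the local ring at `A` modulo the two local equations. -/
noncomputable def interMult (A : ℙ L (Fin 3 → L)) (f g : MvPolynomial (Fin 3) L) : ℕ∞ :=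
  Module.length L (LocalRing L ⧸ Ideal.span
    {algebraMap (MvPolynomial (Fin 2) L) (LocalRing L) (localEq A f),
     algebraMap (MvPolynomial (Fin 2) L) (LocalRing L) (localEq A g)})

end PlaneCurve

namespace Generic

variable (K : Type*) [Field K]

/-- The algebraic closure of the field `K(x₁,…,x₄,y₁,…,y₄)` of rational functions. -/
abbrev GenField : Type _ :=
  AlgebraicClosure (FractionRing (MvPolynomial (Fin 4 ⊕ Fin 4) K))

/-- The inclusion of the polynomials in `x₁,…,x₄,y₁,…,y₄`. -/
noncomputable def incl : MvPolynomial (Fin 4 ⊕ Fin 4) K →+* GenField K :=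
  (algebraMap (FractionRing (MvPolynomial (Fin 4 ⊕ Fin 4) K)) (GenField K)).comp
    (algebraMap (MvPolynomial (Fin 4 ⊕ Fin 4) K)
      (FractionRing (MvPolynomial (Fin 4 ⊕ Fin 4) K)))

/-- The inclusion of the constants. -/
noncomputable def const : K →+* GenField K := (incl K).comp C

noncomputable def x (i : Fin 4) : GenField K := incl K (X (Sum.inl i))

noncomputable def y (i : Fin 4) : GenField K := incl K (X (Sum.inr i))

/-- Coordinatewise inclusion of `K³`. -/
noncomputable def vecIncl : (Fin 3 → K) →ₛₗ[const K] (Fin 3 → GenField K) where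
  toFun v i := const K (v i)
  map_add' v w := by funext i; simp
  map_smul' c v := by funext i; simp

theorem vecIncl_injective : Function.Injective (vecIncl K) := fun v w h => by
  funext i
  exact (const K).injective (congrFun h i)

variable {K}

/-- A point of the plane over `K`, seen as a point over the big field. -/
noncomputable def point (A : ℙ K (Fin 3 → K)) : ℙ (GenField K) (Fin 3 → GenField K) :=
  Projectivization.map (vecIncl K) (vecIncl_injective K) A

/-- `W₁ = x₁ p₁ + ⋯ + x₄ p₄`. -/
noncomputable def W₁ (P : ProjRatMap K 3 4) : MvPolynomial (Fin 3) (GenField K) :=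
  ∑ i : Fin 4, C (x K i) * MvPolynomial.map (const K) (P.coords i)

/-- `W₂ = y₁ p₁ + ⋯ + y₄ p₄`. -/
noncomputable def W₂ (P : ProjRatMap K 3 4) : MvPolynomial (Fin 3) (GenField K) :=
  ∑ i : Fin 4, C (y K i) * MvPolynomial.map (const K) (P.coords i)

/-- `V₁ = x₁ s₁ + x₂ s₂ + x₃ s₃`. -/
noncomputable def V₁ (S : ProjRatMap K 3 3) : MvPolynomial (Fin 3) (GenField K) :=
  ∑ i : Fin 3, C (x K i.castSucc) * MvPolynomial.map (const K) (S.coords i)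

/-- `V₂ = y₁ s₁ + y₂ s₂ + y₃ s₃`. -/
noncomputable def V₂ (S : ProjRatMap K 3 3) : MvPolynomial (Fin 3) (GenField K) :=
  ∑ i : Fin 3, C (y K i.castSucc) * MvPolynomial.map (const K) (S.coords i)

/-- The multiplicity of `A` as a base point of the parametrization `P`. -/
noncomputable def baseMultP (P : ProjRatMap K 3 4) (A : ℙ K (Fin 3 → K)) : ℕ∞ :=
  PlaneCurve.interMult (point A) (W₁ P) (W₂ P)

/-- The multiplicity of `A` as a base point of the plane map `S`. -/
noncomputable def baseMultS (S : ProjRatMap K 3 3) (A : ℙ K (Fin 3 → K)) : ℕ∞ :=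
  PlaneCurve.interMult (point A) (V₁ S) (V₂ S)

end Generic

/-! Write `d` for the degree of `Q`, and let `I` be the ideal generated by the germs `σ` of the
forms of `S` at `A`. Because `Q` has no base points, substituting the coprime forms of `S` into
those of `Q` creates no common factor, so `P` is this substitution up to a constant
(`exists_coords_eq_of_compEq`). Hence the base loci agree. Moreover `W₁`, `W₂` are generic members
of the system of `Q`, evaluated at `σ`, and `V₁`, `V₂` are generic linear forms in `σ`.

Multiplicity: if `μ` is the least order of the `σ j`, their parts of order `μ` do not all vanish.
Since `Q` has no base points, some form of `Q` is nonzero on them, so the order becomes exactly `μ *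
d`. Independence of the indeterminates over `K` excludes cancellation in the generic members
(`mult_member_eq`).

Intersection multiplicity: the germs `σ` satisfy, up to higher order, a nonzero homogeneous relation
`G` over `K`. Two generic members have no common zero on the curve `G = 0`, so by the
Nullstellensatz and Nakayama's lemma `(V₁, V₂)` is a reduction of `I` and `(W₁, W₂)` a reduction of
`I ^ d` (`isRegularPair_member`). For an ideal `q` generated by a regular pair, `q ^ n` has colength
`n (n + 1) / 2` times that of `q`. Comparing quadratic growth gives the ratio `d ^ 2` of the two
intersection multiplicities (`length_eq_of_reduction`).

Finally, `deg T = d ^ 2` (`degree_eq`): the Hilbert function of `T` grows like `deg T * n ^ 2 / 2`,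
and birationality identifies it, up to a bounded shift of degree, with the number of plane forms of
degree `d * n`. -/

section Growth

/-- Comparison of leading coefficients of two quadratic functions. -/
theorem Nat.le_of_forall_quadratic_le {a b c e : ℕ}
    (h : ∀ n : ℕ, a * n ^ 2 ≤ b * n ^ 2 + c * n + e) : a ≤ b := by
  by_contra! hab
  -- At `n = c + e + 1` one extra `n ^ 2` already exceeds `c * n + e`.
  have h1 := h (c + e + 1)
  obtain ⟨k, rfl⟩ : ∃ k, a = b + 1 + k := ⟨a - (b + 1), by omega⟩
  nlinarith [Nat.zero_le (k * (c + e + 1) ^ 2), Nat.zero_le (c * e), Nat.zero_le (e * e)]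

end Growth

/-! ### Regular pairs, Hilbert–Samuel functions and reductions -/

section RegularPair

variable (L : Type*) {O : Type*} [Field L] [CommRing O] [Algebra L O]

/-- The pair `a, b` is a regular sequence (without the condition that `(a, b) ≠ O`). -/
structure IsRegularPair (a b : O) : Prop where
  left : ∀ x, a * x = 0 → x = 0
  right : ∀ x, a ∣ b * x → a ∣ x

theorem length_quotient_le_of_le {I J : Ideal O} (h : I ≤ J) :
    Module.length L (O ⧸ J) ≤ Module.length L (O ⧸ I) :=
  Module.length_le_of_surjective (Ideal.Quotient.factorₐ L h).toLinearMap
    (Ideal.Quotient.factor_surjective h)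

/-- Multiplication by `a` gives the exact sequence `0 → O/I → O/J → O/(J + (a)) → 0`; the hypothesis
says that `I` is the colon ideal `(J : a)`. -/
theorem length_quotient_eq_add (a : O) {I J : Ideal O} (h : ∀ x, a * x ∈ J ↔ x ∈ I) :
    Module.length L (O ⧸ J) =
      Module.length L (O ⧸ I) + Module.length L (O ⧸ (J ⊔ Ideal.span {a})) := by
  let f : (O ⧸ I) →ₗ[O] (O ⧸ J) :=
    Submodule.mapQ I J (LinearMap.mulLeft O a) fun x hx => (h x).2 hx
  refine Module.length_eq_add_of_exact (f.restrictScalars L)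
    (Ideal.Quotient.factorₐ L (le_sup_left : J ≤ J ⊔ Ideal.span {a})).toLinearMap ?_
    (Ideal.Quotient.factor_surjective le_sup_left) ?_
  · refine (injective_iff_map_eq_zero (f.restrictScalars L)).2 fun x hx => ?_
    obtain ⟨x, rfl⟩ := Ideal.Quotient.mk_surjective x
    have hx' : Ideal.Quotient.mk J (a * x) = 0 := hx
    rw [Ideal.Quotient.eq_zero_iff_mem] at hx' ⊢
    exact (h x).1 hx'
  · intro y
    obtain ⟨y, rfl⟩ := Ideal.Quotient.mk_surjective y
    have h1 : (Ideal.Quotient.factorₐ L (le_sup_left : J ≤ J ⊔ Ideal.span {a})).toLinearMap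
      (Ideal.Quotient.mk J y) = Ideal.Quotient.mk (J ⊔ Ideal.span {a}) y := rfl
    rw [h1, Ideal.Quotient.eq_zero_iff_mem]
    constructor
    · intro hy
      obtain ⟨j, hj, z, hz, rfl⟩ := Submodule.mem_sup.1 hy
      obtain ⟨x, rfl⟩ := Ideal.mem_span_singleton.1 hz
      refine ⟨Ideal.Quotient.mk I x, ?_⟩
      change Ideal.Quotient.mk J (a * x) = _
      rw [map_add, Ideal.Quotient.eq_zero_iff_mem.2 hj, zero_add]
    · rintro ⟨x, hx⟩
      obtain ⟨x, rfl⟩ := Ideal.Quotient.mk_surjective x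
      have hx' : Ideal.Quotient.mk J (a * x) = Ideal.Quotient.mk J y := hx
      rw [Ideal.Quotient.eq] at hx'
      have : y = -(a * x - y) + a * x := by ring
      rw [this]
      exact add_mem (neg_mem (Ideal.mem_sup_left hx'))
        (Ideal.mem_sup_right (Ideal.mul_mem_right _ _ (Ideal.mem_span_singleton_self a)))

variable {a b : O}

theorem IsRegularPair.dvd_of_dvd_pow_mul (h : IsRegularPair a b) (n : ℕ) {x : O}
    (hx : a ∣ b ^ n * x) : a ∣ x := by
  induction n with
  | zero => simpa using hx
  | succ n ih => exact ih (h.right _ (by rwa [pow_succ', mul_assoc] at hx))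

/-- Peel off one factor `b` at a time: regularity gives `((a, b ^ (n + 1)) : b) = (a, b ^ n)`. -/
theorem IsRegularPair.length_span_pow_right (h : IsRegularPair a b) (n : ℕ) :
    Module.length L (O ⧸ Ideal.span {a, b ^ n}) = n * Module.length L (O ⧸ Ideal.span {a, b}) := by
  induction n with
  | zero =>
    have : Ideal.span {a, b ^ 0} = (⊤ : Ideal O) :=
      (Ideal.eq_top_iff_one _).2 (Ideal.subset_span (by simp))
    rw [this, Nat.cast_zero, zero_mul]
    have := (Ideal.Quotient.subsingleton_iff (I := (⊤ : Ideal O))).2 rfl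
    exact Module.length_eq_zero
  | succ n ih =>
    rw [length_quotient_eq_add L b (I := Ideal.span {a, b ^ n}), ih]
    · have : Ideal.span {a, b ^ (n + 1)} ⊔ Ideal.span {b} = Ideal.span {a, b} := by
        apply le_antisymm
        · rw [sup_le_iff, Ideal.span_le, Ideal.span_le]
          constructor
          · rintro x (rfl | rfl)
            · exact Ideal.subset_span (by simp)
            · exact Ideal.pow_mem_of_mem _ (Ideal.subset_span (by simp)) _ (Nat.succ_pos _)
          · rintro x rfl
            exact Ideal.subset_span (by simp)
        · rw [Ideal.span_le]
          rintro x (rfl | rfl)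
          · exact Ideal.mem_sup_left (Ideal.subset_span (by simp))
          · exact Ideal.mem_sup_right (Ideal.subset_span (by simp))
      rw [this]
      push_cast
      ring
    · intro x
      rw [Ideal.mem_span_pair, Ideal.mem_span_pair]
      constructor
      · rintro ⟨s, t, hst⟩
        obtain ⟨c, hc⟩ := h.right (x - t * b ^ n) ⟨s, by linear_combination -hst⟩
        exact ⟨c, t, by linear_combination -hc⟩
      · rintro ⟨s, t, rfl⟩
        exact ⟨b * s, t, by ring⟩

/-- The only monomial of degree `n + 1` in `a, b` not divisible by `a` is `b ^ (n + 1)`. -/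
theorem span_pair_pow_succ_le (a b : O) (n : ℕ) :
    Ideal.span {a, b} ^ (n + 1) ≤
      Ideal.span {a} * Ideal.span {a, b} ^ n ⊔ Ideal.span {b ^ (n + 1)} := by
  have hq : Ideal.span {a, b} = Ideal.span {a} ⊔ Ideal.span {b} := Ideal.span_insert _ _
  induction n with
  | zero => simp [hq]
  | succ n ih =>
    have h1 : Ideal.span {b} ≤ Ideal.span {a, b} := by rw [hq]; exact le_sup_right
    calc Ideal.span {a, b} ^ (n + 1 + 1)
        = Ideal.span {a} * Ideal.span {a, b} ^ (n + 1) ⊔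
          Ideal.span {b} * Ideal.span {a, b} ^ (n + 1) := by
          rw [pow_succ' _ (n + 1), ← Ideal.sup_mul, ← hq]
      _ ≤ _ := by
        refine sup_le le_sup_left ((Ideal.mul_mono_right ih).trans ?_)
        rw [Ideal.mul_sup]
        refine sup_le ?_ ?_
        · rw [mul_left_comm, pow_succ' _ n]
          exact le_sup_of_le_left (Ideal.mul_mono_right (Ideal.mul_mono_left h1))
        · rw [Ideal.span_singleton_mul_span_singleton, ← pow_succ']
          exact le_sup_right

/-- With `q = (a, b)`, regularity gives `(q ^ (n + 1) : a) = q ^ n`, while `q ^ (n + 1) + (a) = (a,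
b ^ (n + 1))` has colength `n + 1` times that of `q`. -/
theorem IsRegularPair.length_span_pow_succ (h : IsRegularPair a b) (n : ℕ) :
    Module.length L (O ⧸ Ideal.span {a, b} ^ (n + 1)) =
      Module.length L (O ⧸ Ideal.span {a, b} ^ n) +
        (n + 1 : ℕ) * Module.length L (O ⧸ Ideal.span {a, b}) := by
  have ha : a ∈ Ideal.span {a, b} := Ideal.subset_span (by simp)
  have hb : b ∈ Ideal.span {a, b} := Ideal.subset_span (by simp)
  rw [length_quotient_eq_add L a (I := Ideal.span {a, b} ^ n), ← h.length_span_pow_right L]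
  · have : Ideal.span {a, b} ^ (n + 1) ⊔ Ideal.span {a} = Ideal.span {a, b ^ (n + 1)} := by
      rw [Ideal.span_insert a {b ^ (n + 1)}]
      refine le_antisymm (sup_le ((span_pair_pow_succ_le a b n).trans ?_) le_sup_left) ?_
      · exact sup_le_sup_right Ideal.mul_le_left _
      · refine sup_le le_sup_right (le_sup_of_le_left ?_)
        rw [Ideal.span_singleton_le_iff_mem]
        exact Ideal.pow_mem_pow hb _
    rw [this]
  · intro x
    constructor
    · intro hx
      obtain ⟨y, hy, z, hz, hyz⟩ := Submodule.mem_sup.1 (span_pair_pow_succ_le a b n hx)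
      obtain ⟨y, hy', rfl⟩ := Ideal.mem_span_singleton_mul.1 hy
      obtain ⟨c, rfl⟩ := Ideal.mem_span_singleton.1 hz
      obtain ⟨e, rfl⟩ := h.dvd_of_dvd_pow_mul (n + 1) (x := c) ⟨x - y, by linear_combination hyz⟩
      have h0 := h.left (x - y - b ^ (n + 1) * e) (by linear_combination -hyz)
      have : x = y + b * e * b ^ n := by linear_combination h0
      rw [this]
      exact add_mem hy' (Ideal.mul_mem_left _ _ (Ideal.pow_mem_pow hb _))
    · intro hx
      rw [pow_succ']
      exact Ideal.mul_mem_mul ha hx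

theorem IsRegularPair.two_mul_length_span_pow (h : IsRegularPair a b) (n : ℕ) :
    2 * Module.length L (O ⧸ Ideal.span {a, b} ^ n) =
      (n * (n + 1) : ℕ) * Module.length L (O ⧸ Ideal.span {a, b}) := by
  induction n with
  | zero =>
    have := (Ideal.Quotient.subsingleton_iff (I := (⊤ : Ideal O))).2 rfl
    rw [pow_zero, Ideal.one_eq_top, Module.length_eq_zero]
    simp
  | succ n ih =>
    rw [h.length_span_pow_succ L, mul_add, ih]
    push_cast
    ring

/-- Both colengths are quadratic in `n`; the shift `r` affects only lower terms, so the leading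
coefficients compare. -/
theorem IsRegularPair.length_le_of_pow_le {c e : O} (h : IsRegularPair a b)
    (h' : IsRegularPair c e) {d r : ℕ}
    (hl : Module.length L (O ⧸ Ideal.span {a, b}) ≠ ⊤)
    (hl' : Module.length L (O ⧸ Ideal.span {c, e}) ≠ ⊤)
    {d' : ℕ} (hle : ∀ n, Ideal.span {c, e} ^ (d' * n + r) ≤ Ideal.span {a, b} ^ (d * n)) :
    (d ^ 2 : ℕ) * Module.length L (O ⧸ Ideal.span {a, b}) ≤
      (d' ^ 2 : ℕ) * Module.length L (O ⧸ Ideal.span {c, e}) := by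
  obtain ⟨A, hA⟩ := ENat.ne_top_iff_exists.1 hl
  obtain ⟨B, hB⟩ := ENat.ne_top_iff_exists.1 hl'
  rw [← hA, ← hB]
  norm_cast
  -- These are the lower coefficients of `(d' * n + r) * (d' * n + r + 1) * B`.
  apply Nat.le_of_forall_quadratic_le (c := B * (d' * (2 * r + 1))) (e := B * (r * (r + 1)))
  intro n
  have h1 := mul_le_mul_right (length_quotient_le_of_le L (hle n)) 2
  rw [h.two_mul_length_span_pow L, h'.two_mul_length_span_pow L, ← hA, ← hB] at h1
  norm_cast at h1
  nlinarith [Nat.zero_le (d * n * A)]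

/-- Two parameter ideals, the first having the same integral closure as the `d`-th power of the
second. -/
theorem IsRegularPair.length_eq {c e : O} (h : IsRegularPair a b)
    (h' : IsRegularPair c e) {d r s : ℕ}
    (hl : Module.length L (O ⧸ Ideal.span {a, b}) ≠ ⊤)
    (hl' : Module.length L (O ⧸ Ideal.span {c, e}) ≠ ⊤)
    (h1 : ∀ n, Ideal.span {c, e} ^ (n + r) ≤ Ideal.span {a, b} ^ (d * n))
    (h2 : ∀ n, Ideal.span {a, b} ^ (d * n + s) ≤ Ideal.span {c, e} ^ n) :
    Module.length L (O ⧸ Ideal.span {c, e}) =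
      (d ^ 2 : ℕ) * Module.length L (O ⧸ Ideal.span {a, b}) := by
  apply le_antisymm
  · simpa using h'.length_le_of_pow_le L h (d := 1) (d' := d) hl' hl (by simpa using h2)
  · simpa using h.length_le_of_pow_le L h' (d := d) (d' := 1) hl hl' (by simpa using h1)

/-- If `I` is an ideal of which `(a, b)` is a reduction and `(c, e)` a reduction of `I ^ d`,
the colengths are in the ratio `1 : d ^ 2`. -/
theorem IsRegularPair.length_eq_of_reduction {c e : O} (h : IsRegularPair a b)
    (h' : IsRegularPair c e) {d : ℕ}
    (hl : Module.length L (O ⧸ Ideal.span {a, b}) ≠ ⊤)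
    (hl' : Module.length L (O ⧸ Ideal.span {c, e}) ≠ ⊤) {I : Ideal O} {r s : ℕ}
    (hab : Ideal.span {a, b} ≤ I) (hce : Ideal.span {c, e} ≤ I ^ d)
    (h1 : I ^ (r + 1) ≤ Ideal.span {a, b} * I ^ r)
    (h2 : I ^ (s + d) ≤ Ideal.span {c, e} * I ^ s) :
    Module.length L (O ⧸ Ideal.span {c, e}) =
      (d ^ 2 : ℕ) * Module.length L (O ⧸ Ideal.span {a, b}) := by
  -- Iterating the reduction `n` times gives `I ^ (k * n + t) ≤ q ^ n * I ^ t`.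
  have key : ∀ (q : Ideal O) (t k : ℕ), I ^ (t + k) ≤ q * I ^ t →
      ∀ n, I ^ (k * n + t) ≤ q ^ n := by
    intro q t k hq n
    have : I ^ (k * n + t) ≤ q ^ n * I ^ t := by
      induction n with
      | zero => simp
      | succ n ih =>
        calc I ^ (k * (n + 1) + t) = I ^ k * I ^ (k * n + t) := by rw [← pow_add]; congr 1; ring
          _ ≤ I ^ k * (q ^ n * I ^ t) := Ideal.mul_mono_right ih
          _ = q ^ n * I ^ (t + k) := by rw [pow_add]; ring
          _ ≤ q ^ n * (q * I ^ t) := Ideal.mul_mono_right hq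
          _ = q ^ (n + 1) * I ^ t := by ring
    exact this.trans Ideal.mul_le_left
  refine h.length_eq L h' (r := r) (s := s) hl hl' (fun n => ?_) fun n => ?_
  · obtain rfl | hd := Nat.eq_zero_or_pos d
    · simp
    · have h3 := Ideal.pow_right_mono hce (n + r)
      rw [← pow_mul] at h3
      refine (h3.trans (Ideal.pow_le_pow_right ?_)).trans (key _ r 1 h1 (d * n))
      nlinarith
  · exact (Ideal.pow_right_mono hab _).trans (key _ s d h2 n)

end RegularPair

/-! ### The local ring of the plane at the origin -/

namespace PlaneCurve

variable (L : Type*) [Field L]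

/-- The germ at the origin of the `i`-th coordinate function. -/
noncomputable def coordGerm (i : Fin 2) : LocalRing L := algebraMap (MvPolynomial (Fin 2) L) _ (X i)

theorem algebraMap_localRing_injective :
    Function.Injective (algebraMap (MvPolynomial (Fin 2) L) (LocalRing L)) :=
  IsLocalization.injective _ (originIdeal L).primeCompl_le_nonZeroDivisors

instance : IsDomain (LocalRing L) :=
  IsLocalization.isDomain_of_le_nonZeroDivisors _ (originIdeal L).primeCompl_le_nonZeroDivisors

variable {L}

theorem algebraMap_mem_maximalIdeal_iff {p : MvPolynomial (Fin 2) L} :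
    algebraMap _ (LocalRing L) p ∈ IsLocalRing.maximalIdeal (LocalRing L) ↔
      constantCoeff p = 0 :=
  IsLocalization.AtPrime.to_map_mem_maximal_iff _ (originIdeal L) p

theorem isUnit_algebraMap_iff {p : MvPolynomial (Fin 2) L} :
    IsUnit (algebraMap _ (LocalRing L) p) ↔ constantCoeff p ≠ 0 :=
  IsLocalization.AtPrime.isUnit_to_map_iff _ (originIdeal L) p

/-- The prime `(X i)` lies inside the ideal of the origin, so it survives localization. -/
theorem coordGerm_prime (i : Fin 2) : Prime (coordGerm L i) := by
  have h0 : coordGerm L i ≠ 0 := fun h =>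
    X_ne_zero (R := L) i (algebraMap_localRing_injective L (h.trans (map_zero _).symm))
  rw [← Ideal.span_singleton_prime h0]
  have hX : (Ideal.span {(X i : MvPolynomial (Fin 2) L)}).IsPrime :=
    (Ideal.span_singleton_prime (X_ne_zero i)).2 (X_prime (i := i))
  have := IsLocalization.isPrime_of_isPrime_disjoint (originIdeal L).primeCompl (LocalRing L)
    (Ideal.span {(X i : MvPolynomial (Fin 2) L)}) hX (by
      rw [Set.disjoint_left]
      intro p hp hp'
      obtain ⟨q, rfl⟩ := Ideal.mem_span_singleton.1 hp'
      exact hp (by simp [originIdeal]))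
  rwa [Ideal.map_span, Set.image_singleton] at this

theorem not_coordGerm_dvd {i j : Fin 2} (hij : i ≠ j) : ¬ coordGerm L i ∣ coordGerm L j := by
  rintro ⟨c, hc⟩
  obtain ⟨⟨p, s⟩, hps⟩ := IsLocalization.surj (originIdeal L).primeCompl c
  have h1 : algebraMap (MvPolynomial (Fin 2) L) (LocalRing L) (X j * (s : MvPolynomial (Fin 2) L)) =
      algebraMap (MvPolynomial (Fin 2) L) (LocalRing L) (X i * p) := by
    rw [map_mul, map_mul, ← hps]
    change coordGerm L j * _ = coordGerm L i * _
    rw [hc]; ring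
  have h2 : X i ∣ X j * (s : MvPolynomial (Fin 2) L) :=
    ⟨p, algebraMap_localRing_injective L h1⟩
  rcases (X_prime (i := i)).dvd_or_dvd h2 with h | h
  · rw [X_dvd_X] at h
    exact hij h
  · obtain ⟨q, hq⟩ := h
    exact s.2 (by rw [hq]; simp [originIdeal])

theorem coordGerm_pow_dvd {i j : Fin 2} (hij : i ≠ j) {a b : ℕ} {e : LocalRing L}
    (h : coordGerm L i ^ a ∣ coordGerm L j ^ b * e) : coordGerm L i ^ a ∣ e :=
  (coordGerm_prime i).pow_dvd_of_dvd_mul_left a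
    (fun h' => not_coordGerm_dvd hij ((coordGerm_prime i).dvd_of_dvd_pow h')) h

theorem isRegularPair_coordGerm : IsRegularPair (coordGerm L 0) (coordGerm L 1) where
  left x hx := (mul_eq_zero.1 hx).resolve_left (coordGerm_prime 0).ne_zero
  right x hx := by
    simpa using coordGerm_pow_dvd (L := L) (i := 0) (j := 1) (by decide) (a := 1) (b := 1)
      (by simpa using hx)

/-- Modulo the two coordinates a germ is its value at the origin, so the quotient is an image of
`L`. -/
theorem length_coordGerm_ne_top :
    Module.length L (LocalRing L ⧸ Ideal.span {coordGerm L 0, coordGerm L 1}) ≠ ⊤ := by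
  set m : Ideal (LocalRing L) := Ideal.span {coordGerm L 0, coordGerm L 1} with hm
  have hmem : ∀ p : MvPolynomial (Fin 2) L,
      algebraMap _ (LocalRing L) (p - C (constantCoeff p)) ∈ m := by
    intro p
    have h1 : p - C (constantCoeff p) ∈ Ideal.span (Set.range (X : Fin 2 → MvPolynomial _ L)) := by
      rw [← pow_one (Ideal.span _), mem_pow_idealOfVars_iff']
      intro x hx
      have : x = 0 := by
        simpa only [Nat.lt_one_iff, Finsupp.degree_eq_zero_iff] using hx
      simp [this, constantCoeff_eq]
    have h2 := Ideal.mem_map_of_mem (algebraMap _ (LocalRing L)) h1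
    rw [Ideal.map_span] at h2
    refine Ideal.span_le.2 ?_ h2
    rintro _ ⟨_, ⟨i, rfl⟩, rfl⟩
    apply Ideal.subset_span
    fin_cases i
    · exact Or.inl rfl
    · exact Or.inr rfl
  have hsurj : Function.Surjective (Algebra.linearMap L (LocalRing L ⧸ m)) := by
    intro y
    obtain ⟨y, rfl⟩ := Ideal.Quotient.mk_surjective y
    obtain ⟨⟨p, s⟩, hps⟩ := IsLocalization.surj (originIdeal L).primeCompl y
    have hs : constantCoeff (s : MvPolynomial (Fin 2) L) ≠ 0 := s.2
    have hval : ∀ q : MvPolynomial (Fin 2) L,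
        Ideal.Quotient.mk m (algebraMap _ _ q) =
          algebraMap L (LocalRing L ⧸ m) (constantCoeff q) := by
      intro q
      have h3 := Ideal.Quotient.eq_zero_iff_mem.2 (hmem q)
      rw [map_sub, map_sub, sub_eq_zero] at h3
      rw [h3]
      rfl
    refine ⟨constantCoeff p / constantCoeff (s : MvPolynomial (Fin 2) L), ?_⟩
    have h4 := congrArg (Ideal.Quotient.mk m) hps
    simp only [map_mul, hval] at h4
    have h5 : algebraMap L (LocalRing L ⧸ m) (constantCoeff (s : MvPolynomial (Fin 2) L)) *
        algebraMap L (LocalRing L ⧸ m) (constantCoeff (s : MvPolynomial (Fin 2) L))⁻¹ = 1 := by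
      rw [← map_mul, mul_inv_cancel₀ hs, map_one]
    rw [Algebra.linearMap_apply, div_eq_mul_inv, map_mul, ← h4, mul_assoc, h5, mul_one]
  refine ne_top_of_le_ne_top ?_ (Module.length_le_of_surjective _ hsurj)
  exact Module.length_ne_top

/-- `J` contains a power of the ideal of the two coordinates, whose colength is finite by the
formula for regular pairs. -/
theorem length_ne_top_of_pow_mem {J : Ideal (LocalRing L)} {a b : ℕ}
    (ha : coordGerm L 0 ^ a ∈ J) (hb : coordGerm L 1 ^ b ∈ J) :
    Module.length L (LocalRing L ⧸ J) ≠ ⊤ := by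
  have h1 : Ideal.span {coordGerm L 0, coordGerm L 1} ^ (a + b) ≤ J := by
    rw [Ideal.span_insert]
    refine (Ideal.sup_pow_add_le_pow_sup_pow).trans (sup_le ?_ ?_)
    · rwa [Ideal.span_singleton_pow, Ideal.span_singleton_le_iff_mem]
    · rwa [Ideal.span_singleton_pow, Ideal.span_singleton_le_iff_mem]
  refine ne_top_of_le_ne_top ?_ (length_quotient_le_of_le L h1)
  intro h
  have h2 := (isRegularPair_coordGerm (L := L)).two_mul_length_span_pow L (a + b)
  rw [h] at h2
  obtain ⟨k, hk⟩ := ENat.ne_top_iff_exists.1 (length_coordGerm_ne_top (L := L))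
  rw [← hk, ENat.mul_top (by norm_num)] at h2
  exact ENat.natCast_ne_top _ (h2.trans (by push_cast; rfl)).symm

/-- Two elements of the maximal ideal of the local ring of the plane generating an ideal of finite
colength form a regular sequence. -/
theorem isRegularPair_of_pow_mem {f g : LocalRing L} {a b : ℕ}
    (hg : g ∈ IsLocalRing.maximalIdeal (LocalRing L))
    (ha : coordGerm L 0 ^ a ∈ Ideal.span {f, g}) (hb : coordGerm L 1 ^ b ∈ Ideal.span {f, g}) :
    IsRegularPair f g := by
  obtain ⟨s, t, hst⟩ := Ideal.mem_span_pair.1 ha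
  obtain ⟨s', t', hst'⟩ := Ideal.mem_span_pair.1 hb
  have hu : coordGerm L 0 ^ a ≠ 0 := pow_ne_zero _ (coordGerm_prime 0).ne_zero
  -- If `f = 0`, both coordinate powers are multiples of `g`; their coprimality makes `g` a unit.
  have hf : f ≠ 0 := by
    rintro rfl
    have h1 : coordGerm L 0 ^ a ∣ coordGerm L 1 ^ b * t :=
      ⟨t', by rw [← hst, ← hst']; ring⟩
    obtain ⟨k, rfl⟩ := coordGerm_pow_dvd (by decide) h1
    have h2 : g * k = 1 := mul_left_cancel₀ hu (by linear_combination hst)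
    exact (IsLocalRing.mem_maximalIdeal g).1 hg (IsUnit.of_mul_eq_one _ h2)
  refine ⟨fun x hx => (mul_eq_zero.1 hx).resolve_left hf, ?_⟩
  rintro x ⟨y, hy⟩
  -- `f` divides both coordinate powers times `x`; since these powers are coprime, `f` divides `x`.
  have h1 : coordGerm L 0 ^ a * x = f * (s * x + t * y) := by
    rw [← hst]; linear_combination t * hy
  have h2 : coordGerm L 1 ^ b * x = f * (s' * x + t' * y) := by
    rw [← hst']; linear_combination t' * hy
  have h3 : coordGerm L 1 ^ b * (s * x + t * y) = coordGerm L 0 ^ a * (s' * x + t' * y) :=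
    mul_left_cancel₀ hf (by linear_combination coordGerm L 0 ^ a * h2 - coordGerm L 1 ^ b * h1)
  obtain ⟨k, hk⟩ := coordGerm_pow_dvd (by decide) ⟨_, h3⟩
  exact ⟨k, mul_left_cancel₀ hu (by rw [h1, hk]; ring)⟩

end PlaneCurve

/-! ### Coprime families in factorial rings -/

section Coprime

open Polynomial in
/-- A coprime finite family of polynomials over a unique factorization domain generates an ideal
containing a nonzero constant. -/
theorem Polynomial.exists_C_mem_span_of_coprime {R ι : Type*} [CommRing R] [IsDomain R]
    [UniqueFactorizationMonoid R] (f : ι → R[X])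
    (hf : ∀ h, (∀ i, h ∣ f i) → IsUnit h) :
    ∃ r : R, r ≠ 0 ∧ Polynomial.C r ∈ Ideal.span (Set.range f) := by
  classical
  let : NormalizedGCDMonoid R := Nonempty.some inferInstance
  let K := FractionRing R
  let φ : R[X] →+* K[X] := Polynomial.mapRingHom (algebraMap R K)
  have hφ : Function.Injective φ := Polynomial.map_injective _ (IsFractionRing.injective R K)
  -- Over the fraction field the ideal is principal. By Gauss's lemma the primitive part of the
  -- cleared generator divides every `f i`, so `g` is a unit; clearing denominators in `1` then
  -- gives `r`.
  obtain ⟨g, hg⟩ :=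
    (IsPrincipalIdealRing.principal (Ideal.map φ (Ideal.span (Set.range f)))).principal
  have hdvd : ∀ i, g ∣ φ (f i) := fun i => by
    have h1 : φ (f i) ∈ Ideal.map φ (Ideal.span (Set.range f)) :=
      Ideal.mem_map_of_mem _ (Ideal.subset_span ⟨i, rfl⟩)
    rw [hg] at h1
    exact Ideal.mem_span_singleton.1 h1
  have hg0 : g ≠ 0 := by
    rintro rfl
    exact not_isUnit_zero (hf 0 fun i => by
      have h1 := hdvd i
      rw [zero_dvd_iff] at h1
      rw [hφ (h1.trans (map_zero φ).symm)])
  have hgu : IsUnit g := by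
    refine isUnit_or_eq_zero_of_isUnit_integerNormalization_primPart (R := R) hg0 (hf _ fun i => ?_)
    refine (isPrimitive_primPart _).dvd_of_fraction_map_dvd_fraction_map (K := K) ?_
    refine dvd_trans ?_ (hdvd i)
    set N := IsLocalization.integerNormalization (nonZeroDivisors R) g with hN
    obtain ⟨b, hb0, hb⟩ := IsLocalization.integerNormalization_spec (nonZeroDivisors R) g
    have h1 : N.primPart.map (algebraMap R K) ∣ N.map (algebraMap R K) :=
      Polynomial.map_dvd _ (primPart_dvd N)
    refine h1.trans ?_
    have h2 : N.map (algebraMap R K) = b • g := hb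
    have hbK : algebraMap R K b ≠ 0 := fun h => nonZeroDivisors.ne_zero hb0
      (IsFractionRing.injective R K (h.trans (map_zero _).symm))
    rw [h2]
    refine ⟨Polynomial.C (algebraMap R K b)⁻¹, ?_⟩
    rw [Algebra.smul_def, mul_comm, ← mul_assoc]
    have h3 : algebraMap R K[X] b = Polynomial.C (algebraMap R K b) := rfl
    rw [h3, ← Polynomial.C_mul, inv_mul_cancel₀ hbK, Polynomial.C_1, one_mul]
  have h1 : (1 : K[X]) ∈ Ideal.map φ (Ideal.span (Set.range f)) := by
    rw [hg]
    exact Ideal.mem_span_singleton.2 hgu.dvd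
  let := Polynomial.algebra (R := R) (A := K)
  have := Polynomial.isLocalization (nonZeroDivisors R) K
  obtain ⟨⟨⟨x, hx⟩, ⟨_, r, hr, rfl⟩⟩, h2⟩ := (IsLocalization.mem_map_algebraMap_iff
    (Submonoid.map Polynomial.C (nonZeroDivisors R)) K[X]).1 h1
  rw [one_mul] at h2
  refine ⟨r, nonZeroDivisors.ne_zero hr, ?_⟩
  have h3 : (Polynomial.C r : R[X]) = x := hφ h2
  rwa [h3]

/-- Two proportional coprime tuples agree up to a unit. -/
theorem exists_unit_mul_eq_of_proportional {R ι : Type*} [CommRing R] [IsDomain R]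
    [UniqueFactorizationMonoid R] [Finite ι] {p r : ι → R}
    (hp : ∀ h, (∀ i, h ∣ p i) → IsUnit h) (hr : ∀ h, (∀ i, h ∣ r i) → IsUnit h)
    (hr0 : ∃ i, r i ≠ 0) (hpr : ∀ i j, r i * p j = r j * p i) :
    ∃ c : R, IsUnit c ∧ ∀ i, p i = c * r i := by
  classical
  have := Fintype.ofFinite ι
  let : NormalizedGCDMonoid R := Nonempty.some inferInstance
  -- `a i` divides every `b i * a j`, hence `b i` times the gcd of the `a j`, which is a unit.
  have key : ∀ a b : ι → R, (∀ h, (∀ i, h ∣ a i) → IsUnit h) → (∀ i j, a i * b j = a j * b i) →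
      ∀ i, a i ∣ b i := by
    intro a b ha hab i
    have h1 : a i ∣ Finset.univ.gcd fun j => b i * a j :=
      Finset.dvd_gcd fun j _ => ⟨b j, by rw [mul_comm, hab i j]⟩
    have h2 := Finset.gcd_mul_left' Finset.univ a (b i)
    have h3 : IsUnit (Finset.univ.gcd a) := ha _ fun j => Finset.gcd_dvd (Finset.mem_univ j)
    exact (h1.trans h2.dvd).trans (by
      obtain ⟨u, hu⟩ := h3
      exact ⟨(u⁻¹ : Rˣ), by rw [← hu, mul_assoc, Units.mul_inv, mul_one]⟩)
  obtain ⟨i, hi⟩ := hr0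
  obtain ⟨c, hc⟩ := key r p hr hpr i
  obtain ⟨e, he⟩ := key p r hp (fun i j => by rw [mul_comm, hpr j i, mul_comm]) i
  refine ⟨c, IsUnit.of_mul_eq_one e (mul_left_cancel₀ hi ?_), fun j => mul_left_cancel₀ hi ?_⟩
  · rw [← mul_assoc, ← hc, ← he, mul_one]
  · rw [hpr i j, hc]; ring

end Coprime

/-! ### Ideals of forms and the projective Nullstellensatz -/

namespace MvPolynomial

/-- A coprime family of forms in `n + 1` variables generates an ideal containing a nonzero form
which does not involve a given variable. -/
theorem exists_form_mem_span_of_coprime {K ι : Type*} [Field K] {n m : ℕ}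
    (s : ι → MvPolynomial (Fin (n + 1)) K) (hs : ∀ i, (s i).IsHomogeneous m)
    (hc : ∀ h, (∀ i, h ∣ s i) → IsUnit h) (j : Fin (n + 1)) :
    ∃ (a : MvPolynomial (Fin n) K) (k : ℕ), a ≠ 0 ∧ a.IsHomogeneous k ∧
      rename j.succAbove a ∈ Ideal.span (Set.range s) := by
  -- Treat `X j` as the variable over the ring in the others; constants then do not involve `X j`.
  let Φ : MvPolynomial (Fin (n + 1)) K ≃ₐ[K] Polynomial (MvPolynomial (Fin n) K) :=
    (renameEquiv K (finSuccEquiv' j)).trans (optionEquivLeft K (Fin n))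
  have hΦ : ∀ r, Φ (rename j.succAbove r) = Polynomial.C r := by
    intro r
    have : (Φ : MvPolynomial (Fin (n + 1)) K →ₐ[K] _).comp (rename j.succAbove) =
        Polynomial.CAlgHom (A := MvPolynomial (Fin n) K) (R := K) := by
      ext i
      simp [Φ, finSuccEquiv'_succAbove]
    exact DFunLike.congr_fun this r
  obtain ⟨r, hr0, hr⟩ := Polynomial.exists_C_mem_span_of_coprime (fun i => Φ (s i)) fun h hh => by
    have := hc (Φ.symm h) fun i => by
      obtain ⟨x, hx⟩ := hh i
      exact ⟨Φ.symm x, by rw [← map_mul, ← hx, AlgEquiv.symm_apply_apply]⟩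
    simpa using this.map Φ
  have hr' : rename j.succAbove r ∈ Ideal.span (Set.range s) := by
    have h1 : Ideal.span (Set.range fun i => Φ (s i)) =
        Ideal.map Φ (Ideal.span (Set.range s)) := by
      rw [Ideal.map_span, ← Set.range_comp]; rfl
    rw [h1, ← hΦ] at hr
    obtain ⟨x, hx, hxr⟩ := (Ideal.mem_map_iff_of_surjective Φ Φ.surjective).1 hr
    rwa [← Φ.injective hxr]
  let := gradedAlgebra (σ := Fin (n + 1)) (R := K)
  have hhom : (Ideal.span (Set.range s)).IsHomogeneous (homogeneousSubmodule (Fin (n + 1)) K) :=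
    Ideal.homogeneous_span _ _ (by rintro _ ⟨i, rfl⟩; exact ⟨m, hs i⟩)
  -- The ideal is homogeneous, so it also contains each component of `r`.
  obtain ⟨k, hk⟩ : ∃ k, homogeneousComponent k r ≠ 0 := by
    by_contra! h
    exact hr0 (by rw [← sum_homogeneousComponent r]; exact Finset.sum_eq_zero fun k _ => h k)
  refine ⟨homogeneousComponent k r, k, hk, homogeneousComponent_isHomogeneous k r, ?_⟩
  rw [rename_homogeneousComponent]
  exact homogeneousComponent_mem_of_mem hhom hr' k

/-- The projective Nullstellensatz. -/
theorem exists_pow_idealOfVars_le {L σ : Type*} [Field L] [IsAlgClosed L] [Finite σ]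
    (J : Ideal (MvPolynomial σ L))
    (hJ : ∀ v : σ → L, (∀ p ∈ J, eval v p = 0) → v = 0) :
    ∃ N, idealOfVars σ L ^ N ≤ J := by
  refine Ideal.exists_pow_le_of_le_radical_of_fg ?_ (idealOfVars_fg σ L)
  rw [← vanishingIdeal_zeroLocus_eq_radical (K := L), Ideal.span_le]
  rintro _ ⟨i, rfl⟩
  intro v hv
  have : v = 0 := hJ v fun p hp => by simpa [aeval_eq_eval] using hv p hp
  simp [this]

/-- A form in the ideal generated by forms is a combination of them with forms as coefficients. -/
theorem IsHomogeneous.exists_coeff_of_mem_span {R σ ι : Type*} [CommRing R] [Fintype ι]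
    {p : ι → MvPolynomial σ R} {e : ι → ℕ} (hp : ∀ i, (p i).IsHomogeneous (e i))
    {f : MvPolynomial σ R} {n : ℕ} (hf : f.IsHomogeneous n) (hn : ∀ i, e i ≤ n)
    (h : f ∈ Ideal.span (Set.range p)) :
    ∃ A : ι → MvPolynomial σ R, (∀ i, (A i).IsHomogeneous (n - e i)) ∧ f = ∑ i, A i * p i := by
  obtain ⟨B, rfl⟩ := Ideal.mem_span_range_iff_exists_fun.1 h
  -- Take the degree `n` part of the relation; `hn` makes the subtraction `n - e i` genuine.
  refine ⟨fun i => homogeneousComponent (n - e i) (B i),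
    fun i => homogeneousComponent_isHomogeneous _ _, ?_⟩
  rw [← homogeneousComponent_eq_self hf, map_sum]
  refine Finset.sum_congr rfl fun i _ => ?_
  let := gradedAlgebra (σ := σ) (R := R)
  have h1 := DirectSum.coe_decompose_mul_of_right_mem_of_le (homogeneousSubmodule σ R)
    (a := B i) (b := p i) (hp i) (hn i)
  exact (decomposition.decompose'_apply _ _).symm.trans
    (h1.trans (congrArg (· * p i) (decomposition.decompose'_apply _ _)))

theorem IsHomogeneous.aeval_smul {R A σ : Type*} [CommSemiring R] [CommSemiring A] [Algebra R A]
    {p : MvPolynomial σ R} {n : ℕ} (hp : p.IsHomogeneous n) (c : A) (v : σ → A) :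
    MvPolynomial.aeval (c • v) p = c ^ n * MvPolynomial.aeval v p := by
  classical
  rw [aeval_def, aeval_def, eval₂_eq, eval₂_eq, Finset.mul_sum]
  refine Finset.sum_congr rfl fun d hd => ?_
  have h1 : ∏ i ∈ d.support, (c • v) i ^ d i = c ^ n * ∏ i ∈ d.support, v i ^ d i := by
    rw [hp.degree_eq_sum_deg_support hd, ← Finset.prod_pow_eq_pow_sum,
      ← Finset.prod_mul_distrib]
    exact Finset.prod_congr rfl fun i _ => by simp [mul_pow]
  rw [h1]; ring

end MvPolynomial

namespace ProjRatMap

theorem eq_zero_of_baseLocus_eq_empty {K : Type*} [Field K] {n m : ℕ} {f : ProjRatMap K n m}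
    (hf : f.baseLocus = ∅) {v : Fin n → K} (hv : ∀ i, eval v (f.coords i) = 0) : v = 0 := by
  by_contra hv0
  have : Projectivization.mk K v hv0 ∈ f.baseLocus := by
    intro i
    obtain ⟨a, ha⟩ := Projectivization.exists_smul_eq_mk_rep K v hv0
    rw [← ha]
    have h2 := (f.homogeneous i).aeval_smul (a : K) v
    rw [aeval_eq_eval, aeval_eq_eval] at h2
    have h3 : (a • v) = ((a : K) • v) := rfl
    rw [h3]
    exact h2.trans (by simp [hv])
  rw [hf] at this
  exact this

end ProjRatMap

namespace MvPolynomial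

theorem aeval_mem_span_range_pow {R A σ : Type*} [CommSemiring R] [CommSemiring A] [Algebra R A]
    (τ : σ → A) {p : MvPolynomial σ R} {n : ℕ} (hp : p ∈ idealOfVars σ R ^ n) :
    aeval τ p ∈ Ideal.span (Set.range τ) ^ n := by
  have h1 : Ideal.map (aeval τ : MvPolynomial σ R →ₐ[R] A) (idealOfVars σ R) =
      Ideal.span (Set.range τ) := by
    rw [Ideal.map_span, ← Set.range_comp]
    congr 2
    ext i
    simp
  rw [← h1, ← Ideal.map_pow]
  exact Ideal.mem_map_of_mem _ hp

theorem span_range_pow_eq_span {R A σ : Type*} [CommSemiring R] [CommSemiring A] [Algebra R A]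
    (τ : σ → A) (n : ℕ) :
    Ideal.span (Set.range τ) ^ n = Ideal.span
      ((fun d => aeval τ (monomial d (1 : R))) '' (Finsupp.degree ⁻¹' {n})) := by
  have h1 : Ideal.map (aeval τ : MvPolynomial σ R →ₐ[R] A) (idealOfVars σ R) =
      Ideal.span (Set.range τ) := by
    rw [Ideal.map_span, ← Set.range_comp]
    congr 2
    ext i
    simp
  rw [← h1, ← Ideal.map_pow, pow_idealOfVars_eq_span, Ideal.map_span, ← Set.image_comp]
  rfl

theorem IsHomogeneous.mem_pow_idealOfVars {R σ : Type*} [CommSemiring R] {p : MvPolynomial σ R}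
    {n : ℕ} (hp : p.IsHomogeneous n) : p ∈ idealOfVars σ R ^ n := by
  rw [mem_pow_idealOfVars_iff']
  intro x hx
  exact hp.coeff_eq_zero hx.ne

/-- A nonzero of `X k * p` can be rescaled to have `k`-th coordinate `1`. This shows that
dehomogenizing a nonzero form gives a nonzero polynomial. -/
theorem IsHomogeneous.exists_eval_ne_zero_of_eq_one {K σ : Type*} [Field K] [Infinite K]
    {p : MvPolynomial σ K} {n : ℕ} (hp : p.IsHomogeneous n) (hp0 : p ≠ 0) (k : σ) :
    ∃ x : σ → K, x k = 1 ∧ eval x p ≠ 0 := by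
  obtain ⟨x, hx⟩ : ∃ x : σ → K, eval x (X k * p) ≠ 0 := by
    by_contra! h
    exact mul_ne_zero (X_ne_zero k) hp0 (MvPolynomial.funext fun x => by rw [h x, map_zero])
  rw [map_mul, eval_X, mul_ne_zero_iff] at hx
  refine ⟨(x k)⁻¹ • x, by simp [hx.1], ?_⟩
  have h1 := hp.aeval_smul (x k)⁻¹ x
  rw [aeval_eq_eval, aeval_eq_eval] at h1
  have h2 : eval ((x k)⁻¹ • x) p = (x k)⁻¹ ^ n * eval x p := h1
  rw [h2]
  exact mul_ne_zero (pow_ne_zero _ (inv_ne_zero hx.1)) hx.2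

/-- Three polynomials in two variables satisfy a nontrivial homogeneous relation up to terms of
higher order. -/
theorem exists_form_aeval_mem_pow {K : Type*} [Field K] (τ : Fin 3 → MvPolynomial (Fin 2) K) :
    ∃ (G : MvPolynomial (Fin 3) K) (g : ℕ), G ≠ 0 ∧ G.IsHomogeneous g ∧
      aeval τ G ∈ Ideal.span (Set.range τ) ^ (g + 1) := by
  classical
  -- Three elements in a ring of transcendence degree two.
  have hdep : ¬ AlgebraicIndependent K τ := by
    intro h
    have h1 := h.lift_cardinalMk_le_trdeg
    rw [MvPolynomial.trdeg_of_isDomain] at h1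
    simp at h1
    norm_cast at h1
  obtain ⟨H, hH, hH0⟩ : ∃ H : MvPolynomial (Fin 3) K, aeval τ H = 0 ∧ H ≠ 0 := by
    simpa [algebraicIndependent_iff] using hdep
  have hex : ∃ k, homogeneousComponent k H ≠ 0 := by
    by_contra! h
    exact hH0 (by rw [← sum_homogeneousComponent H]; exact Finset.sum_eq_zero fun k _ => h k)
  -- The component of least degree: the rest of `H` has order above `g`, and `H` itself vanishes at
  -- `τ`.
  refine ⟨homogeneousComponent (Nat.find hex) H, Nat.find hex, Nat.find_spec hex,
    homogeneousComponent_isHomogeneous _ _, ?_⟩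
  have h1 : H - homogeneousComponent (Nat.find hex) H ∈
      idealOfVars (Fin 3) K ^ (Nat.find hex + 1) := by
    rw [mem_pow_idealOfVars_iff']
    intro x hx
    rw [coeff_sub, coeff_homogeneousComponent]
    split_ifs with h
    · exact sub_self _
    · have h2 : homogeneousComponent x.degree H = 0 := by
        by_contra h3
        exact Nat.find_min hex (m := x.degree) (by omega) h3
      have h4 := coeff_homogeneousComponent x.degree H x
      rw [h2, if_pos rfl, coeff_zero] at h4
      rw [sub_zero, ← h4]
  have h2 := aeval_mem_span_range_pow τ h1
  rw [map_sub, hH, zero_sub] at h2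
  exact (neg_mem_iff).1 h2

end MvPolynomial

/-! ### Reductions from forms without common zeros -/

section Reduction

/-- If the forms `G, w₁, w₂` have no common zero and `G (σ)` vanishes to higher order, then
`(w₁ (σ), w₂ (σ))` is a reduction of a power of the ideal generated by `σ`. -/
theorem exists_reduction {F O : Type*} [Field F] [IsAlgClosed F] [CommRing O] [Algebra F O]
    [IsLocalRing O] [IsNoetherianRing O] {n : ℕ} (σ : Fin n → O)
    (hσ : ∀ i, σ i ∈ IsLocalRing.maximalIdeal O) {g d : ℕ} {G w₁ w₂ : MvPolynomial (Fin n) F}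
    (hG : G.IsHomogeneous g) (h₁ : w₁.IsHomogeneous d) (h₂ : w₂.IsHomogeneous d)
    (hzero : ∀ v : Fin n → F, eval v G = 0 → eval v w₁ = 0 → eval v w₂ = 0 → v = 0)
    (hGσ : aeval σ G ∈ Ideal.span (Set.range σ) ^ (g + 1)) :
    ∃ r, Ideal.span (Set.range σ) ^ (r + d) ≤
      Ideal.span {aeval σ w₁, aeval σ w₂} * Ideal.span (Set.range σ) ^ r := by
  set I := Ideal.span (Set.range σ) with hI
  obtain ⟨N, hN⟩ := exists_pow_idealOfVars_le (Ideal.span (Set.range ![G, w₁, w₂])) fun v hv =>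
    hzero v (hv _ (Ideal.subset_span ⟨0, rfl⟩)) (hv _ (Ideal.subset_span ⟨1, rfl⟩))
      (hv _ (Ideal.subset_span ⟨2, rfl⟩))
  -- Nakayama: it suffices to prove the inclusion modulo `I * I ^ (N + g + d)`. A monomial of that
  -- degree is a combination of `G, w₁, w₂`; the term with `G` drops into this error because `G (σ)`
  -- lies in `I ^ (g + 1)`.
  refine ⟨N + g, Submodule.le_of_le_smul_of_le_jacobson_bot (I := I) (IsNoetherian.noetherian _)
    ?_ ?_⟩
  · rw [IsLocalRing.jacobson_eq_maximalIdeal _ bot_ne_top, hI, Ideal.span_le]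
    rintro _ ⟨i, rfl⟩
    exact hσ i
  · refine (span_range_pow_eq_span (R := F) σ _).trans_le (Ideal.span_le.2 ?_)
    rintro _ ⟨x, hx, rfl⟩
    have hx' : (monomial x (1 : F)).IsHomogeneous (N + g + d) := isHomogeneous_monomial _ hx
    obtain ⟨A, hA, hAx⟩ := hx'.exists_coeff_of_mem_span (p := ![G, w₁, w₂]) (e := ![g, d, d])
      (by intro i; fin_cases i <;> assumption)
      (by intro i; fin_cases i <;> simp <;> omega)
      (hN (Ideal.pow_le_pow_right (by omega) hx'.mem_pow_idealOfVars))
    have hmem : ∀ i, aeval σ (A i) ∈ I ^ (N + g + d - ![g, d, d] i) := fun i =>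
      aeval_mem_span_range_pow σ (hA i).mem_pow_idealOfVars
    have m0 : aeval σ (A 0) ∈ I ^ (N + d) := by
      have := hmem 0
      simpa [show N + g + d - g = N + d by omega] using this
    have m1 : aeval σ (A 1) ∈ I ^ (N + g) := by simpa using hmem 1
    have m2 : aeval σ (A 2) ∈ I ^ (N + g) := by simpa using hmem 2
    change aeval σ (monomial x (1 : F)) ∈ _
    rw [hAx, Fin.sum_univ_three]
    simp only [map_add, map_mul, Matrix.cons_val_zero, Matrix.cons_val_one, Matrix.cons_val]
    have hcomm : ∀ a b c : O, a + b + c = b + c + a := fun _ _ _ => by ring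
    rw [hcomm]
    refine Submodule.add_mem_sup (add_mem ?_ ?_) ?_
    · rw [mul_comm (aeval σ (A 1))]
      exact Ideal.mul_mem_mul (Ideal.subset_span (by simp)) m1
    · rw [mul_comm (aeval σ (A 2))]
      exact Ideal.mul_mem_mul (Ideal.subset_span (by simp)) m2
    · have := Ideal.mul_mem_mul m0 hGσ
      rw [← pow_add, show N + d + (g + 1) = 1 + (N + g + d) by ring, pow_add, pow_one] at this
      exact this

end Reduction

/-! ### Generic members have no common zero on a fixed curve -/

namespace Generic

/-- Two generic members of a system of forms without base points have no common zero on a plane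
curve defined over the ground field. -/
theorem eq_zero_of_generic {K F : Type*} [Field K] [Infinite K] [Field F] [Algebra K F] {m d g : ℕ}
    {z : Fin m ⊕ Fin m → F} (hz : AlgebraicIndependent K z) {G : MvPolynomial (Fin 3) K}
    (hG0 : G ≠ 0) (hG : G.IsHomogeneous g) {q : Fin m → MvPolynomial (Fin 3) K}
    (hq : ∀ i, (q i).IsHomogeneous d)
    (hbase : ∀ v : Fin 3 → F, (∀ i, aeval v (q i) = 0) → v = 0) {v : Fin 3 → F}
    (h0 : aeval v G = 0) (h1 : ∑ i, z (Sum.inl i) * aeval v (q i) = 0)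
    (h2 : ∑ i, z (Sum.inr i) * aeval v (q i) = 0) : v = 0 := by
  classical
  by_contra hv
  obtain ⟨k, hk⟩ := Function.ne_iff.1 hv
  rw [Pi.zero_apply] at hk
  obtain ⟨w, hwk, hw⟩ : ∃ w : Fin 3 → F, w k = 1 ∧ w = (v k)⁻¹ • v :=
    ⟨(v k)⁻¹ • v, by simp [hk], rfl⟩
  have hwq : ∀ i, aeval w (q i) = (v k)⁻¹ ^ d * aeval v (q i) := fun i => by
    rw [hw]; exact (hq i).aeval_smul _ _
  have h0' : aeval w G = 0 := by rw [hw, hG.aeval_smul, h0, mul_zero]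
  have hsum : ∀ t : Fin m → F, ∑ i, t i * aeval v (q i) = 0 → ∑ i, t i * aeval w (q i) = 0 := by
    intro t ht
    simp_rw [hwq, fun i => mul_left_comm (t i)]
    rw [← Finset.mul_sum, ht, mul_zero]
  replace h1 := hsum _ h1
  replace h2 := hsum _ h2
  obtain ⟨i₀, hi₀⟩ : ∃ i, aeval w (q i) ≠ 0 := by
    by_contra! h
    have := hbase w h
    rw [this] at hwk
    exact zero_ne_one hwk
  -- A rank count. The `2 * m` independent elements `z` would be algebraic over `B`: the affine
  -- coordinates `w'` of the point, of rank at most one since it lies on `G = 0`, together with all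
  -- but two of the `z`.
  let M := AlgebraicIndependent.matroid K F
  let w' : Fin 2 → F := fun j => w (k.succAbove j)
  have hww' : w = Fin.insertNth (α := fun _ => F) k 1 w' := by
    funext i
    refine Fin.succAboveCases k ?_ (fun j => ?_) i
    · simp [hwk]
    · simp [w']
  have hdep : ¬ AlgebraicIndependent K w' := by
    intro h
    have h3 : aeval w' (aeval (Fin.insertNth (α := fun _ => MvPolynomial (Fin 2) K) k 1 X) G) =
        aeval w G := by
      rw [← AlgHom.comp_apply]
      congr 1
      ext i
      rw [hww']
      refine Fin.succAboveCases k ?_ (fun j => ?_) i <;> simp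
    rw [h0'] at h3
    have h4 := (algebraicIndependent_iff.1 h) _ h3
    obtain ⟨x, hxk, hx⟩ := hG.exists_eval_ne_zero_of_eq_one hG0 k
    apply hx
    have h5 : eval (fun j => x (k.succAbove j))
        (aeval (Fin.insertNth (α := fun _ => MvPolynomial (Fin 2) K) k 1 X) G) = eval x G := by
      rw [← aeval_eq_eval, ← aeval_eq_eval]
      rw [← AlgHom.comp_apply]
      congr 1
      ext i
      refine Fin.succAboveCases k ?_ (fun j => ?_) i <;> simp [hxk]
    rw [← h5, h4, map_zero]
  have hrk : M.eRk (Set.range w') ≤ 1 := by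
    by_contra! hlt
    have hcard : (Set.range w').encard ≤ 2 := by
      have := Set.encard_le_encard (s := Set.range w') (t := {w' 0, w' 1}) (by
        rintro _ ⟨i, rfl⟩
        fin_cases i <;> simp)
      refine this.trans ((Set.encard_insert_le _ _).trans ?_)
      rw [Set.encard_singleton, one_add_one_eq_two]
    have hinj : Function.Injective w' := by
      intro a b hab
      by_contra hne
      have hsub : Set.range w' ⊆ {w' a} := by
        rintro _ ⟨i, rfl⟩
        have : i = a ∨ i = b := by omega
        rcases this with rfl | rfl
        · simp
        · simp [hab]
      have := (M.eRk_le_encard _).trans (Set.encard_le_encard hsub)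
      rw [Set.encard_singleton] at this
      exact absurd hlt (not_lt.2 this)
    apply hdep
    have hfin := Set.finite_range w'
    have hind : M.Indep (Set.range w') := by
      rw [Matroid.indep_iff_eRk_eq_encard_of_finite hfin]
      refine le_antisymm (M.eRk_le_encard _) (hcard.trans ?_)
      exact Order.add_one_le_of_lt hlt
    exact AlgebraicIndependent.of_subtype_range hinj hind
  let T : Set F := z '' {s | s ≠ Sum.inl i₀ ∧ s ≠ Sum.inr i₀}
  let B : Set F := Set.range w' ∪ T
  have hB : M.eRk B < M.eRk (Set.range z) := by
    let S : Set (Fin m ⊕ Fin m) := {s | s ≠ Sum.inl i₀ ∧ s ≠ Sum.inr i₀}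
    have hz1 : M.eRk (Set.range z) = S.encard + 2 := by
      have hind : M.Indep (Set.range z) := hz.to_subtype_range
      have hS : (Set.univ : Set (Fin m ⊕ Fin m)) = S ∪ {Sum.inl i₀, Sum.inr i₀} := by
        ext s
        by_cases h1 : s = Sum.inl i₀ <;> by_cases h2 : s = Sum.inr i₀ <;> simp [S, h1, h2]
      rw [hind.eRk_eq_encard, ← Set.image_univ, hz.injective.encard_image, hS,
        Set.encard_union_eq, Set.encard_pair (by simp)]
      rw [Set.disjoint_left]
      rintro s hs (rfl | rfl)
      · exact hs.1 rfl
      · exact hs.2 rfl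
    have hB1 : M.eRk B ≤ 1 + S.encard := by
      refine (M.eRk_union_le_eRk_add_eRk _ _).trans (add_le_add hrk ?_)
      exact (M.eRk_le_encard _).trans (Set.encard_image_le _ _)
    refine hB1.trans_lt ?_
    rw [hz1]
    obtain ⟨c, hc⟩ := ENat.ne_top_iff_exists.1 (Set.encard_ne_top_iff.2 S.toFinite)
    rw [← hc]
    norm_cast
    omega
  have hcl : Set.range z ⊆ M.closure B := by
    rw [AlgebraicIndependent.matroid_closure_eq]
    let E := Subalgebra.algebraicClosure (Algebra.adjoin K B) F
    have hBE : ∀ b ∈ B, b ∈ E := fun b hb =>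
      isAlgebraic_algebraMap (⟨b, Algebra.subset_adjoin hb⟩ : Algebra.adjoin K B)
    have hKE : ∀ c : K, algebraMap K F c ∈ E := fun c =>
      isAlgebraic_algebraMap (algebraMap K (Algebra.adjoin K B) c)
    have hwE : ∀ i, w i ∈ E := by
      intro i
      refine Fin.succAboveCases k ?_ (fun j => ?_) i
      · rw [hwk]; exact one_mem E
      · exact hBE _ (Or.inl ⟨j, rfl⟩)
    have hqE : ∀ i, aeval w (q i) ∈ E := by
      intro i
      induction q i using MvPolynomial.induction_on with
      | C a => rw [aeval_C]; exact hKE a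
      | add p r hp hr => rw [map_add]; exact add_mem hp hr
      | mul_X p i hp => rw [map_mul, aeval_X]; exact mul_mem hp (hwE i)
    -- Each linear equation determines its missing coefficient, since `q i₀` is nonzero at `w`.
    have hsolve : ∀ t : Fin m → F, ∑ i, t i * aeval w (q i) = 0 → (∀ i, i ≠ i₀ → t i ∈ E) →
        t i₀ ∈ E := by
      intro t ht htE
      rw [← Finset.add_sum_erase _ _ (Finset.mem_univ i₀)] at ht
      have h3 : t i₀ = (-∑ i ∈ Finset.univ.erase i₀, t i * aeval w (q i)) *
          (aeval w (q i₀))⁻¹ := by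
        rw [eq_mul_inv_iff_mul_eq₀ hi₀]
        linear_combination ht
      rw [h3]
      refine mul_mem (neg_mem (sum_mem fun i hi => mul_mem (htE i (Finset.ne_of_mem_erase hi))
        (hqE i))) ?_
      exact IsAlgebraic.inv (hqE i₀)
    have hT : ∀ s, s ≠ Sum.inl i₀ → s ≠ Sum.inr i₀ → z s ∈ E := fun s hs hs' =>
      hBE _ (Or.inr ⟨s, ⟨hs, hs'⟩, rfl⟩)
    rintro _ ⟨s | s, rfl⟩
    · by_cases hs : s = i₀
      · subst hs
        exact hsolve (fun i => z (Sum.inl i)) h1 fun i hi => hT _ (by simpa using hi) (by simp)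
      · exact hT _ (by simpa using hs) (by simp)
    · by_cases hs : s = i₀
      · subst hs
        exact hsolve (fun i => z (Sum.inr i)) h2 fun i hi => hT _ (by simp) (by simpa using hi)
      · exact hT _ (by simp) (by simpa using hs)
  have := M.eRk_mono hcl
  rw [Matroid.eRk_closure_eq] at this
  exact absurd hB (not_lt.2 this)

end Generic

/-! ### Charts and germs -/

namespace PlaneCurve

variable {L : Type*} [Field L]

/-- Restriction to the `k`-th standard chart, with the point with coordinates `c` moved to the
origin. -/
noncomputable def dehom (k : Fin 3) (c : Fin 2 → L) :
    MvPolynomial (Fin 3) L →ₐ[L] MvPolynomial (Fin 2) L :=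
  aeval (Fin.insertNth (α := fun _ => MvPolynomial (Fin 2) L) k 1 (fun j => X j + C (c j)))

theorem localEq_eq_dehom (A : ℙ L (Fin 3 → L)) (f : MvPolynomial (Fin 3) L) :
    localEq A f =
      dehom (chart A) (fun j => A.rep ((chart A).succAbove j) / A.rep (chart A)) f := rfl

theorem constantCoeff_dehom (k : Fin 3) (c : Fin 2 → L) (f : MvPolynomial (Fin 3) L) :
    constantCoeff (dehom k c f) = eval (Fin.insertNth (α := fun _ => L) k 1 c) f := by
  have : (constantCoeff : MvPolynomial (Fin 2) L →+* L).comp (dehom k c).toRingHom =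
      eval (Fin.insertNth (α := fun _ => L) k 1 c) := by
    ext i
    · simp [dehom]
    · refine Fin.succAboveCases k ?_ (fun j => ?_) i <;> simp [dehom]
  exact DFunLike.congr_fun this f

theorem map_dehom {K : Type*} [Field K] (φ : K →+* L) (k : Fin 3) (c : Fin 2 → K)
    (f : MvPolynomial (Fin 3) K) :
    map φ (dehom k c f) = dehom k (φ ∘ c) (map φ f) := by
  have : (map φ).comp (dehom k c).toRingHom = (dehom k (φ ∘ c)).toRingHom.comp (map φ) := by
    ext i : 2
    · simp [dehom]
    · refine Fin.succAboveCases k ?_ (fun j => ?_) i <;> simp [dehom]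
  exact DFunLike.congr_fun this f

/-- The germ at `A` of a form, in the local ring of the plane at the origin. -/
noncomputable def germ (A : ℙ L (Fin 3 → L)) : MvPolynomial (Fin 3) L →ₐ[L] LocalRing L :=
  (IsScalarTower.toAlgHom L (MvPolynomial (Fin 2) L) (LocalRing L)).comp
    (dehom (chart A) (fun j => A.rep ((chart A).succAbove j) / A.rep (chart A)))

theorem germ_apply (A : ℙ L (Fin 3 → L)) (f : MvPolynomial (Fin 3) L) :
    germ A f = algebraMap (MvPolynomial (Fin 2) L) (LocalRing L) (localEq A f) := rfl

/-- A coprime family of forms contains a power of each local coordinate in the ideal it generates,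
locally at any point. -/
theorem exists_X_pow_mul_mem_span [Infinite L] {ι : Type*} {s : ι → MvPolynomial (Fin 3) L} {m : ℕ}
    (hs : ∀ i, (s i).IsHomogeneous m) (hc : ∀ h, (∀ i, h ∣ s i) → IsUnit h) (k : Fin 3)
    (c : Fin 2 → L) (i : Fin 2) :
    ∃ (r : ℕ) (b : MvPolynomial (Fin 2) L), constantCoeff b ≠ 0 ∧
      X i ^ r * b ∈ Ideal.span (Set.range fun j => dehom k c (s j)) := by
  -- Eliminate the other affine coordinate `i'`: the resulting form involves only the homogenizing
  -- variable and coordinate `i`. In the chart it is a nonzero one-variable polynomial `α`, a power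
  -- of `X i` times a unit at the origin.
  obtain ⟨i', hi'⟩ : ∃ i' : Fin 2, ∀ l, l ≠ i' → l = i := by
    refine ⟨1 - i, fun l hl => ?_⟩
    fin_cases i <;> fin_cases l <;> simp_all
  obtain ⟨a, n, ha0, ha, hmem⟩ := exists_form_mem_span_of_coprime s hs hc (k.succAbove i')
  set j := k.succAbove i' with hj
  obtain ⟨l₀, hl₀⟩ := Fin.exists_succAbove_eq (x := k) (y := j) (Fin.succAbove_ne k i').symm
  have hne : ∀ l, l ≠ l₀ → j.succAbove l = k.succAbove i := by
    intro l hl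
    obtain ⟨e, he⟩ := Fin.exists_succAbove_eq (x := j.succAbove l) (y := k) fun h =>
      hl (Fin.succAbove_right_injective (h.trans hl₀.symm))
    rw [← he, hi' e]
    rintro rfl
    exact Fin.succAbove_ne j l he.symm
  let α : Polynomial L :=
    aeval (fun l => if l = l₀ then 1 else Polynomial.X + Polynomial.C (c i)) a
  have hα : dehom k c (rename j.succAbove a) = Polynomial.aeval (X i) α := by
    rw [dehom, aeval_rename, comp_aeval_apply]
    congr 1
    ext1 l
    by_cases hl : l = l₀
    · subst hl
      simp [hl₀]
    · simp [hne l hl, hl, MvPolynomial.algebraMap_eq]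
  have hα0 : α ≠ 0 := by
    intro h0
    obtain ⟨x, hx1, hx⟩ := ha.exists_eval_ne_zero_of_eq_one ha0 l₀
    apply hx
    obtain ⟨t, ht⟩ : ∃ t, ∀ l, l ≠ l₀ → x l = t := by
      refine ⟨x (1 - l₀), fun l hl => ?_⟩
      congr 1
      omega
    have h1 : Polynomial.aeval (t - c i) α = eval x a := by
      rw [comp_aeval_apply, ← aeval_eq_eval]
      change _ = (aeval x) a
      congr 1
      ext1 l
      by_cases hl : l = l₀
      · subst hl; simp [hx1]
      · simp [hl, ht l hl]
    rw [← h1, h0, map_zero]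
  obtain ⟨β, hβ, hβ0⟩ := Polynomial.exists_eq_pow_rootMultiplicity_mul_and_not_dvd α hα0 0
  rw [Polynomial.C_0, sub_zero] at hβ hβ0
  refine ⟨α.rootMultiplicity 0, Polynomial.aeval (X i) β, ?_, ?_⟩
  · have : constantCoeff (Polynomial.aeval (X i : MvPolynomial (Fin 2) L) β) = β.coeff 0 := by
      rw [Polynomial.aeval_def, Polynomial.hom_eval₂, constantCoeff_X, Polynomial.eval₂_at_zero]
      simp [MvPolynomial.algebraMap_eq]
    rw [this]
    rwa [Polynomial.X_dvd_iff] at hβ0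
  · have h1 := Ideal.mem_map_of_mem (dehom k c) hmem
    rw [hα, Ideal.map_span, ← Set.range_comp] at h1
    rw [hβ, map_mul, map_pow, Polynomial.aeval_X] at h1
    exact h1

end PlaneCurve

/-! ### Passage to the big field and generic members -/

namespace Generic

variable {K : Type*} [Field K]

/-- The chosen representative over the big field is a scalar multiple of the one over `K`, and the
scalar cancels in affine coordinates. Thus forms over `K` have local equations over `K`. -/
theorem exists_localEq_point_map (A : ℙ K (Fin 3 → K)) :
    ∃ c : Fin 2 → K, ∃ b : K,
      Fin.insertNth (α := fun _ => K) (PlaneCurve.chart (point A)) 1 c = b • A.rep ∧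
      ∀ f, PlaneCurve.localEq (point A) (map (const K) f) =
        map (const K) (PlaneCurve.dehom (PlaneCurve.chart (point A)) c f) := by
  have h1 : ∃ a : (GenField K)ˣ, a • (vecIncl K A.rep) = (point A).rep := by
    have h2 : point A = Projectivization.mk (GenField K) (vecIncl K A.rep)
        (by rw [← map_zero (vecIncl K)]
            exact fun h => A.rep_nonzero (vecIncl_injective K h)) := by
      conv_lhs => rw [← A.mk_rep]
      rfl
    rw [h2]
    exact Projectivization.exists_smul_eq_mk_rep _ _ _
  obtain ⟨a, ha⟩ := h1
  set k := PlaneCurve.chart (point A) with hk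
  have hrep : ∀ i, (point A).rep i = a * const K (A.rep i) := fun i => by rw [← ha]; rfl
  have hk0 : A.rep k ≠ 0 := fun h => PlaneCurve.chart_spec (point A) (by
    rw [← hk, hrep, h, map_zero, mul_zero])
  refine ⟨fun j => A.rep (k.succAbove j) / A.rep k, (A.rep k)⁻¹, ?_, fun f => ?_⟩
  · ext i
    refine Fin.succAboveCases k ?_ (fun j => ?_) i
    · simp [hk0]
    · simp [div_eq_inv_mul]
  · rw [PlaneCurve.localEq_eq_dehom, PlaneCurve.map_dehom]
    congr 2
    funext j
    rw [← hk, hrep, hrep, mul_div_mul_left _ _ a.ne_zero]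
    simp

/-- The indeterminates `x, y` are algebraically independent over the ground field. -/
theorem algebraicIndependent_xy (K : Type*) [Field K] :
    AlgebraicIndependent K (Sum.elim (x K) (y K)) := by
  have hinj : Function.Injective (incl K) :=
    (FaithfulSMul.algebraMap_injective (FractionRing (MvPolynomial (Fin 4 ⊕ Fin 4) K))
      (GenField K)).comp (IsFractionRing.injective _ _)
  rw [algebraicIndependent_iff]
  intro p hp
  have h1 : ∀ p, aeval (Sum.elim (x K) (y K)) p = incl K p := by
    intro p
    have : (aeval (Sum.elim (x K) (y K)) : MvPolynomial _ K →ₐ[K] GenField K).toRingHom =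
        incl K := by
      ext i
      · simp only [AlgHom.toRingHom_eq_coe, RingHom.coe_comp, RingHom.coe_coe,
          Function.comp_apply, algHom_C]
        rfl
      · rcases i with i | i <;> simp [x, y]
    exact DFunLike.congr_fun this p
  rw [h1] at hp
  exact hinj (hp.trans (map_zero _).symm)

/-- The generic member `∑ zᵢ qᵢ` of a linear system. -/
noncomputable def member {m : ℕ} (z : Fin m → GenField K) (q : Fin m → MvPolynomial (Fin 3) K) :
    MvPolynomial (Fin 3) (GenField K) :=
  ∑ i, C (z i) * map (const K) (q i)

/-- Exhibits `W₁`, `W₂` as fixed forms evaluated at the germs of the `s j`. -/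
theorem aeval_member {m : ℕ} (z : Fin m → GenField K) (q : Fin m → MvPolynomial (Fin 3) K)
    {O : Type*} [CommRing O] [Algebra (GenField K) O]
    (θ : MvPolynomial (Fin 3) (GenField K) →ₐ[GenField K] O) (s : Fin 3 → MvPolynomial (Fin 3) K) :
    aeval (fun j => θ (map (const K) (s j))) (member z q) =
      θ (member z fun i => bind₁ s (q i)) := by
  simp only [member, map_sum, map_mul]
  refine Finset.sum_congr rfl fun i _ => ?_
  congr 1
  · simp [← MvPolynomial.algebraMap_eq]
  · rw [map_bind₁, bind₁, comp_aeval_apply]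

theorem IsHomogeneous_member {m d : ℕ} (z : Fin m → GenField K)
    {q : Fin m → MvPolynomial (Fin 3) K} (hq : ∀ i, (q i).IsHomogeneous d) :
    (member z q).IsHomogeneous d :=
  IsHomogeneous.sum _ _ _ fun i _ => ((hq i).map _).C_mul _

theorem eval_member {m : ℕ} (z : Fin m → GenField K) (q : Fin m → MvPolynomial (Fin 3) K)
    (v : Fin 3 → GenField K) : eval v (member z q) = ∑ i, z i * aeval v (q i) := by
  simp only [member, map_sum, map_mul, eval_C]
  refine Finset.sum_congr rfl fun i _ => ?_
  rw [eval_map]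
  rfl

end Generic

/-! ### Multiplicity of a generic member -/

namespace MvPolynomial

variable {K : Type*} [Field K]

/-- Restriction to the line through the origin in direction `v`. -/
theorem X_pow_dvd_aeval_of_mem_pow {p : MvPolynomial (Fin 2) K} {n : ℕ}
    (hp : p ∈ idealOfVars (Fin 2) K ^ n) (v : Fin 2 → K) :
    Polynomial.X ^ n ∣
      aeval ((Polynomial.X : Polynomial K) • fun i => Polynomial.C (v i)) p := by
  have h1 := aeval_mem_span_range_pow ((Polynomial.X : Polynomial K) • fun i => Polynomial.C (v i))
    hp
  have h2 : Ideal.span (Set.range ((Polynomial.X : Polynomial K) • fun i => Polynomial.C (v i))) ≤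
      Ideal.span {Polynomial.X} := by
    rw [Ideal.span_le]
    rintro _ ⟨i, rfl⟩
    exact Ideal.mem_span_singleton.2 ⟨Polynomial.C (v i), rfl⟩
  have h3 := Ideal.pow_right_mono h2 n h1
  rwa [Ideal.span_singleton_pow, Ideal.mem_span_singleton] at h3

/-- Choose a line `v` on which some degree `μ` part `ini j` is nonzero. Along it `τ = X ^ μ * t`, so
`q i (τ) = X ^ (μ * d) * q i (t)`; if all had higher order, `t` at `0` would be a base point. -/
theorem exists_notMem_pow_succ [Infinite K] {m d μ : ℕ} {τ : Fin 3 → MvPolynomial (Fin 2) K}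
    {q : Fin m → MvPolynomial (Fin 3) K} (hq : ∀ i, (q i).IsHomogeneous d)
    (hbase : ∀ v : Fin 3 → K, (∀ i, eval v (q i) = 0) → v = 0)
    (hτ : ∀ j, τ j ∈ idealOfVars (Fin 2) K ^ μ)
    (hτ' : ∃ j, τ j ∉ idealOfVars (Fin 2) K ^ (μ + 1)) :
    ∃ i, aeval τ (q i) ∉ idealOfVars (Fin 2) K ^ (μ * d + 1) := by
  by_contra! hcon
  obtain ⟨j₀, hj₀⟩ := hτ'
  let ini : Fin 3 → MvPolynomial (Fin 2) K := fun j => homogeneousComponent μ (τ j)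
  have hsub : ∀ j, τ j - ini j ∈ idealOfVars (Fin 2) K ^ (μ + 1) := by
    intro j
    rw [mem_pow_idealOfVars_iff']
    intro x hx
    rw [coeff_sub, coeff_homogeneousComponent]
    split_ifs with h
    · exact sub_self _
    · rw [sub_zero]
      exact (mem_pow_idealOfVars_iff' _ _).1 (hτ j) x (by omega)
  have hne : ini j₀ ≠ 0 := fun h => hj₀ (by simpa [h] using hsub j₀)
  obtain ⟨v, hv⟩ : ∃ v, eval v (ini j₀) ≠ 0 := by
    by_contra! h
    exact hne (MvPolynomial.funext fun x => by rw [h x, map_zero])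
  let ρ : MvPolynomial (Fin 2) K →ₐ[K] Polynomial K :=
    aeval ((Polynomial.X : Polynomial K) • fun i => Polynomial.C (v i))
  have hC : ∀ p : MvPolynomial (Fin 2) K,
      aeval (fun i => Polynomial.C (v i)) p = Polynomial.C (eval v p) := by
    intro p
    have := comp_aeval_apply (f := v) (Algebra.ofId K (Polynomial K)) p
    exact this.symm
  have ht : ∀ j, ∃ t : Polynomial K,
      ρ (τ j) = Polynomial.X ^ μ * t ∧ t.eval 0 = eval v (ini j) := by
    intro j
    obtain ⟨y, hy⟩ := X_pow_dvd_aeval_of_mem_pow (hsub j) v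
    refine ⟨Polynomial.C (eval v (ini j)) + Polynomial.X * y, ?_, by simp⟩
    have h1 : ρ (ini j) = Polynomial.X ^ μ * Polynomial.C (eval v (ini j)) := by
      rw [← hC]
      exact (homogeneousComponent_isHomogeneous μ (τ j)).aeval_smul _ _
    have h2 : ρ (τ j) = ρ (τ j - ini j) + ρ (ini j) := by rw [← map_add, sub_add_cancel]
    rw [h2, h1]
    change aeval _ _ + _ = _
    rw [hy]
    ring
  choose t ht1 ht2 using ht
  have h0 : (fun j => (t j).eval 0) = 0 := by
    apply hbase
    intro i
    have h1 : ρ (aeval τ (q i)) = Polynomial.X ^ (μ * d) * aeval t (q i) := by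
      rw [comp_aeval_apply, pow_mul, ← (hq i).aeval_smul]
      congr 2
      funext j
      exact ht1 j
    have h2 := X_pow_dvd_aeval_of_mem_pow (hcon i) v
    change _ ∣ ρ (aeval τ (q i)) at h2
    rw [h1, pow_succ] at h2
    have h3 := (mul_dvd_mul_iff_left (pow_ne_zero _ Polynomial.X_ne_zero)).1 h2
    obtain ⟨y, hy⟩ := h3
    have h4 := comp_aeval_apply (f := t) (Polynomial.aeval (0 : K)) (q i)
    rw [hy, map_mul, Polynomial.aeval_X, zero_mul] at h4
    exact h4.symm
  have := congrFun h0 j₀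
  rw [ht2] at this
  exact hv this

end MvPolynomial

namespace Generic

variable {K : Type*} [Field K]

/-- Independence of `z` over `K` excludes cancellation: a coefficient of the generic member vanishes
only if it vanishes in every local equation. -/
theorem le_mult_member_iff {m : ℕ} {z : Fin m → GenField K} (hz : LinearIndependent K z)
    {B : ℙ (GenField K) (Fin 3 → GenField K)}
    {τ : MvPolynomial (Fin 3) K →ₐ[K] MvPolynomial (Fin 2) K}
    (hτ : ∀ f, PlaneCurve.localEq B (map (const K) f) = map (const K) (τ f))
    (p : Fin m → MvPolynomial (Fin 3) K) (n : ℕ) :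
    (n : ℕ∞) ≤ PlaneCurve.mult B (member z p) ↔ ∀ i, τ (p i) ∈ idealOfVars (Fin 2) K ^ n := by
  have h1 : PlaneCurve.localEq B (member z p) = ∑ i, C (z i) * map (const K) (τ (p i)) := by
    simp_rw [member, ← hτ]
    rw [PlaneCurve.localEq_eq_dehom, map_sum]
    refine Finset.sum_congr rfl fun i _ => ?_
    rw [map_mul, ← MvPolynomial.algebraMap_eq, AlgHom.commutes]
    rfl
  have hcoeff : ∀ e, coeff e (PlaneCurve.localEq B (member z p)) = 0 ↔
      ∀ i, coeff e (τ (p i)) = 0 := by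
    intro e
    rw [h1, coeff_sum]
    simp only [coeff_C_mul, coeff_map]
    constructor
    · intro h
      refine Fintype.linearIndependent_iff.1 hz _ ?_
      rw [← h]
      exact Finset.sum_congr rfl fun i _ => by rw [Algebra.smul_def, mul_comm]; rfl
    · intro h
      exact Finset.sum_eq_zero fun i _ => by rw [h i, map_zero, mul_zero]
  simp only [mem_pow_idealOfVars_iff']
  constructor
  · intro h i e he
    refine (hcoeff e).1 ?_ i
    rw [← coeff_coe]
    exact MvPowerSeries.coeff_of_lt_order (lt_of_lt_of_le (by exact_mod_cast he) h)
  · intro h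
    refine MvPowerSeries.nat_le_order fun e he => ?_
    rw [coeff_coe]
    exact (hcoeff e).2 fun i => h i e he

theorem mult_member_eq [Infinite K] {m d : ℕ} (hd : 0 < d) (A : ℙ K (Fin 3 → K))
    {s : Fin 3 → MvPolynomial (Fin 3) K} {q : Fin m → MvPolynomial (Fin 3) K}
    (hq : ∀ i, (q i).IsHomogeneous d)
    (hbase : ∀ v : Fin 3 → K, (∀ i, eval v (q i) = 0) → v = 0)
    {z : Fin m → GenField K} (hz : LinearIndependent K z)
    {z' : Fin 3 → GenField K} (hz' : LinearIndependent K z') :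
    PlaneCurve.mult (point A) (member z fun i => bind₁ s (q i)) =
      PlaneCurve.mult (point A) (member z' s) * d := by
  obtain ⟨c, -, -, hc⟩ := exists_localEq_point_map A
  have hW := le_mult_member_iff hz hc fun i => bind₁ s (q i)
  have hV := le_mult_member_iff hz' hc s
  set τ := PlaneCurve.dehom (PlaneCurve.chart (point A)) c
  have hτq : ∀ i, τ (bind₁ s (q i)) = aeval (fun j => τ (s j)) (q i) := fun i => by
    rw [bind₁, comp_aeval_apply]
  simp only [hτq] at hW
  have hpow : ∀ n : ℕ, (n : ℕ∞) ≤ PlaneCurve.mult (point A) (member z' s) →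
      ((n * d : ℕ) : ℕ∞) ≤
        PlaneCurve.mult (point A) (member z fun i => bind₁ s (q i)) := by
    intro n hn
    rw [hW]
    intro i
    have h1 := aeval_mem_span_range_pow (fun j => τ (s j)) (hq i).mem_pow_idealOfVars
    rw [pow_mul]
    refine Ideal.pow_right_mono (Ideal.span_le.2 ?_) d h1
    rintro _ ⟨j, rfl⟩
    exact (hV n).1 hn j
  by_cases htop : PlaneCurve.mult (point A) (member z' s) = ⊤
  · rw [htop, ENat.top_mul (by exact_mod_cast hd.ne'), ENat.eq_top_iff_forall_ge]
    intro n
    refine le_trans ?_ (hpow n (by rw [htop]; exact le_top))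
    exact_mod_cast Nat.le_mul_of_pos_right n hd
  · obtain ⟨μ, hμ⟩ := ENat.ne_top_iff_exists.1 htop
    rw [← hμ]
    refine le_antisymm ?_ (by exact_mod_cast hpow μ hμ.le)
    by_contra! hlt
    have h1 : ((μ * d + 1 : ℕ) : ℕ∞) ≤
        PlaneCurve.mult (point A) (member z fun i => bind₁ s (q i)) := by
      push_cast
      exact Order.add_one_le_of_lt hlt
    rw [hW] at h1
    obtain ⟨i, hi⟩ := exists_notMem_pow_succ hq hbase ((hV μ).1 hμ.le) (by
      by_contra! h
      have := (hV (μ + 1)).2 h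
      rw [← hμ] at this
      norm_cast at this
      omega)
    exact hi (h1 i)

/-! ### Intersection multiplicity of two generic members -/

variable (K) in
/-- Germs at the origin of polynomials over the ground field. -/
noncomputable def constGerm : MvPolynomial (Fin 2) K →+* PlaneCurve.LocalRing (GenField K) :=
  (algebraMap (MvPolynomial (Fin 2) (GenField K)) _).comp (map (const K))

theorem constGerm_X (i : Fin 2) : constGerm K (X i) = PlaneCurve.coordGerm (GenField K) i := by
  simp [constGerm, PlaneCurve.coordGerm]

theorem isUnit_constGerm {p : MvPolynomial (Fin 2) K} (hp : constantCoeff p ≠ 0) :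
    IsUnit (constGerm K p) := by
  refine PlaneCurve.isUnit_algebraMap_iff.2 ?_
  change constantCoeff (map (const K) p) ≠ 0
  rw [constantCoeff_map]
  exact fun h => hp ((const K).injective (h.trans (map_zero _).symm))

theorem constGerm_mem_maximalIdeal {p : MvPolynomial (Fin 2) K} (hp : constantCoeff p = 0) :
    constGerm K p ∈ IsLocalRing.maximalIdeal (PlaneCurve.LocalRing (GenField K)) := by
  refine PlaneCurve.algebraMap_mem_maximalIdeal_iff.2 ?_
  change constantCoeff (map (const K) p) = 0
  rw [constantCoeff_map, hp, map_zero]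

theorem aeval_constGerm {n : ℕ} (τ : Fin n → MvPolynomial (Fin 2) K) (G : MvPolynomial (Fin n) K) :
    aeval (fun j => constGerm K (τ j)) (map (const K) G) = constGerm K (aeval τ G) := by
  have h3 : (aeval (fun j => constGerm K (τ j)) :
      MvPolynomial (Fin n) (GenField K) →ₐ[GenField K] _).toRingHom.comp (map (const K)) =
      (constGerm K).comp (aeval τ : MvPolynomial (Fin n) K →ₐ[K] _).toRingHom := by
    refine ringHom_ext (fun a => ?_) fun j => ?_
    · simp only [RingHom.coe_comp, AlgHom.toRingHom_eq_coe, RingHom.coe_coe, Function.comp_apply,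
        map_C, aeval_C, constGerm, MvPolynomial.algebraMap_eq]
      exact IsScalarTower.algebraMap_apply (GenField K) (MvPolynomial (Fin 2) (GenField K)) _ _
    · simp
  exact DFunLike.congr_fun h3 G

theorem span_constGerm {ι : Type*} (τ : ι → MvPolynomial (Fin 2) K) :
    Ideal.map (constGerm K) (Ideal.span (Set.range τ)) =
      Ideal.span (Set.range fun j => constGerm K (τ j)) := by
  rw [Ideal.map_span, ← Set.range_comp]; rfl

/-- The Nullstellensatz over `K` puts powers of the variables in the ideal of the `q i`, and this
certificate persists over any extension. -/
theorem eq_zero_of_aeval_eq_zero [IsAlgClosed K] {F : Type*} [Field F] [Algebra K F] {m n : ℕ}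
    {q : Fin m → MvPolynomial (Fin n) K}
    (hbase : ∀ v : Fin n → K, (∀ i, eval v (q i) = 0) → v = 0)
    {v : Fin n → F} (hv : ∀ i, aeval v (q i) = 0) : v = 0 := by
  obtain ⟨N, hN⟩ := exists_pow_idealOfVars_le (Ideal.span (Set.range q)) fun v hv =>
    hbase v fun i => hv _ (Ideal.subset_span ⟨i, rfl⟩)
  funext j
  have h1 : Ideal.span (Set.range q) ≤
      RingHom.ker (aeval v : MvPolynomial (Fin n) K →ₐ[K] F) := by
    rw [Ideal.span_le]
    rintro _ ⟨i, rfl⟩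
    exact hv i
  have h2 := h1 (hN (Ideal.pow_mem_pow (Ideal.subset_span (Set.mem_range_self j)) N))
  rw [RingHom.mem_ker, map_pow, aeval_X] at h2
  exact eq_zero_of_pow_eq_zero h2

/-- A linear system without base points, pulled back by a tuple of coprime forms: two generic
members have a finite intersection multiplicity, and they generate a reduction of a power of the
base ideal. -/
theorem isRegularPair_member [IsAlgClosed K] {m d : ℕ} (hd : 0 < d) {A : ℙ K (Fin 3 → K)}
    {S : ProjRatMap K 3 3} (hA : A ∈ S.baseLocus) {q : Fin m → MvPolynomial (Fin 3) K}
    (hq : ∀ i, (q i).IsHomogeneous d)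
    (hbase : ∀ v : Fin 3 → K, (∀ i, eval v (q i) = 0) → v = 0)
    {z z' : Fin m → GenField K} (hz : AlgebraicIndependent K (Sum.elim z z'))
    {I : Ideal (PlaneCurve.LocalRing (GenField K))} (hI : I = Ideal.span (Set.range fun j =>
      PlaneCurve.germ (point A) (map (const K) (S.coords j))))
    {w w' : PlaneCurve.LocalRing (GenField K)}
    (hw : w = PlaneCurve.germ (point A) (member z fun i => bind₁ S.coords (q i)))
    (hw' : w' = PlaneCurve.germ (point A) (member z' fun i => bind₁ S.coords (q i))) :
    IsRegularPair w w' ∧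
      Module.length (GenField K)
        (PlaneCurve.LocalRing (GenField K) ⧸ Ideal.span {w, w'}) ≠ ⊤ ∧
      Ideal.span {w, w'} ≤ I ^ d ∧ ∃ r, I ^ (r + d) ≤ Ideal.span {w, w'} * I ^ r := by
  have : Infinite K := IsAlgClosed.instInfinite
  obtain ⟨c, b, hcb, hc⟩ := exists_localEq_point_map A
  set k := PlaneCurve.chart (point A)
  let τ : Fin 3 → MvPolynomial (Fin 2) K := fun j => PlaneCurve.dehom k c (S.coords j)
  have hσ : (fun j => PlaneCurve.germ (point A) (map (const K) (S.coords j))) =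
      fun j => constGerm K (τ j) := by
    funext j
    rw [PlaneCurve.germ_apply, hc]
    rfl
  have hσm : ∀ j, constGerm K (τ j) ∈
      IsLocalRing.maximalIdeal (PlaneCurve.LocalRing (GenField K)) := by
    intro j
    apply constGerm_mem_maximalIdeal
    rw [PlaneCurve.constantCoeff_dehom, hcb]
    have h1 := (S.homogeneous j).aeval_smul b A.rep
    rw [aeval_eq_eval, aeval_eq_eval] at h1
    have h2 : eval (b • A.rep) (S.coords j) = b ^ S.degree * eval A.rep (S.coords j) := h1
    rw [h2, hA j, mul_zero]
  have hw1 : w = aeval (fun j => constGerm K (τ j)) (member z q) := by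
    rw [hw, ← hσ, aeval_member]
  have hw2 : w' = aeval (fun j => constGerm K (τ j)) (member z' q) := by
    rw [hw', ← hσ, aeval_member]
  rw [hσ] at hI
  clear hw hw' hσ
  have hIm : I ≤ IsLocalRing.maximalIdeal _ := by
    rw [hI, Ideal.span_le]
    rintro _ ⟨j, rfl⟩
    exact hσm j
  -- The relation is sought over `K`, over which `z, z'` are independent; hence the genericity
  -- argument applies to its curve.
  obtain ⟨G, g, hG0, hG, hGτ⟩ := exists_form_aeval_mem_pow τ
  have hGσ : aeval (fun j => constGerm K (τ j)) (map (const K) G) ∈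
      Ideal.span (Set.range fun j => constGerm K (τ j)) ^ (g + 1) := by
    rw [aeval_constGerm, ← span_constGerm, ← Ideal.map_pow]
    exact Ideal.mem_map_of_mem _ hGτ
  have hspan : Ideal.span {w, w'} ≤ I ^ d := by
    rw [Ideal.span_le, hI]
    rintro _ (rfl | rfl)
    · rw [hw1]
      exact aeval_mem_span_range_pow _ (IsHomogeneous_member z hq).mem_pow_idealOfVars
    · rw [hw2]
      exact aeval_mem_span_range_pow _ (IsHomogeneous_member z' hq).mem_pow_idealOfVars
  obtain ⟨r, hr⟩ := exists_reduction (fun j => constGerm K (τ j)) hσm (hG.map (const K))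
    (IsHomogeneous_member z hq) (IsHomogeneous_member z' hq)
    (fun v h0 h1 h2 => by
      rw [eval_member] at h1 h2
      rw [eval_map] at h0
      exact eq_zero_of_generic hz hG0 hG hq (fun v => eq_zero_of_aeval_eq_zero hbase) h0 h1 h2) hGσ
  rw [← hw1, ← hw2, ← hI] at hr
  -- Coprimality of `S` puts a power of each coordinate in `I`, and the reduction moves a higher
  -- power into `(w, w')`.
  have hcoord : ∀ i, ∃ e, PlaneCurve.coordGerm (GenField K) i ^ e ∈ Ideal.span {w, w'} := by
    intro i
    obtain ⟨e, u, hu, heu⟩ :=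
      PlaneCurve.exists_X_pow_mul_mem_span S.homogeneous S.coprime k c i
    have h1 := Ideal.mem_map_of_mem (constGerm K) heu
    rw [span_constGerm, map_mul, map_pow, constGerm_X,
      Ideal.mul_unit_mem_iff_mem _ (isUnit_constGerm hu)] at h1
    have h1' : PlaneCurve.coordGerm (GenField K) i ^ e ∈ I := by rw [hI]; exact h1
    refine ⟨e * (r + d), ?_⟩
    rw [pow_mul]
    exact Ideal.mul_le_left (hr (Ideal.pow_mem_pow h1' _))
  obtain ⟨e₀, h₀⟩ := hcoord 0
  obtain ⟨e₁, h₁⟩ := hcoord 1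
  have hw'm : w' ∈ I ^ d := hspan (Ideal.subset_span (by simp))
  exact ⟨PlaneCurve.isRegularPair_of_pow_mem
    (hIm (Ideal.pow_le_self hd.ne' hw'm)) h₀ h₁,
    PlaneCurve.length_ne_top_of_pow_mem h₀ h₁, hspan, r, hr⟩

end Generic

/-! ### Hilbert functions and the degree of the surface -/

namespace MvPolynomial

theorem finrank_homogeneousSubmodule (K : Type*) [Field K] (m n : ℕ) :
    Module.finrank K (homogeneousSubmodule (Fin m) K n) = (m + n - 1).choose n := by
  have h : homogeneousSubmodule (Fin m) K n =
      restrictSupport K ((Finset.univ : Finset (Fin m)).finsuppAntidiag n : Set (Fin m →₀ ℕ)) := by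
    ext p
    rw [mem_homogeneousSubmodule, mem_restrictSupport_iff]
    constructor
    · intro hp d hd
      have : d.degree = n := by
        by_contra h
        exact (mem_support_iff.1 hd) (hp.coeff_eq_zero h)
      simpa [Finset.mem_finsuppAntidiag, Finsupp.degree_eq_sum] using this
    · intro hp d hd
      have := hp (mem_support_iff.2 hd)
      simpa [Finset.mem_finsuppAntidiag, Finsupp.weight_apply, Finsupp.sum_fintype] using this
  rw [h, Module.finrank_eq_nat_card_basis (basisRestrictSupport K _)]
  simp only [Finset.coe_sort_coe, Nat.card_eq_fintype_card, Fintype.card_coe,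
    Finset.card_finsuppAntidiag_nat_eq_choose, Finset.card_univ, Fintype.card_fin]

instance (K : Type*) [Field K] (m n : ℕ) :
    Module.Finite K (homogeneousSubmodule (Fin m) K n) :=
  Module.Finite.iff_fg.2 (homogeneousSubmodule_fg _ _ n)

/-- Substitution of forms of degree `d`, on forms of degree `n`. -/
noncomputable def substForms {K : Type*} [Field K] {m l d : ℕ} {q : Fin m → MvPolynomial (Fin l) K}
    (hq : ∀ i, (q i).IsHomogeneous d) (n : ℕ) :
    homogeneousSubmodule (Fin m) K n →ₗ[K] homogeneousSubmodule (Fin l) K (d * n) :=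
  (bind₁ q).toLinearMap.restrict fun _ hp => IsHomogeneous.aeval hp q hq

/-- Multiplication by a form. -/
noncomputable def mulForm {K : Type*} [Field K] {m δ : ℕ} {f : MvPolynomial (Fin m) K}
    (hf : f.IsHomogeneous δ) (n : ℕ) :
    homogeneousSubmodule (Fin m) K n →ₗ[K] homogeneousSubmodule (Fin m) K (δ + n) :=
  (LinearMap.mulLeft K f).restrict fun _ hp => hf.mul hp

theorem mulForm_injective {K : Type*} [Field K] {m δ : ℕ} {f : MvPolynomial (Fin m) K}
    (hf : f.IsHomogeneous δ) (hf0 : f ≠ 0) (n : ℕ) : Function.Injective (mulForm hf n) := by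
  intro a b hab
  exact Subtype.ext (mul_left_cancel₀ hf0 (congrArg Subtype.val hab))

/-- The Hilbert function of the image of a parametrization whose image has the equation `f`. -/
theorem finrank_range_substForms_add {K : Type*} [Field K] {m l d δ : ℕ}
    {q : Fin m → MvPolynomial (Fin l) K} (hq : ∀ i, (q i).IsHomogeneous d)
    {f : MvPolynomial (Fin m) K} (hf : f.IsHomogeneous δ) (hf0 : f ≠ 0) (hfq : bind₁ q f = 0)
    (hker : ∀ (n : ℕ) (p : MvPolynomial (Fin m) K), p.IsHomogeneous n → bind₁ q p = 0 → f ∣ p)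
    (n : ℕ) :
    Module.finrank K (LinearMap.range (substForms hq (δ + n))) + (m + n - 1).choose n =
      (m + (δ + n) - 1).choose (δ + n) := by
  rw [← finrank_homogeneousSubmodule K m n, ← finrank_homogeneousSubmodule K m (δ + n),
    ← LinearMap.finrank_range_add_finrank_ker (substForms hq (δ + n)),
    ← LinearMap.finrank_range_of_inj (mulForm_injective hf hf0 n)]
  suffices h : LinearMap.range (mulForm hf n) = LinearMap.ker (substForms hq (δ + n)) by rw [h]
  apply le_antisymm
  · rintro _ ⟨p, rfl⟩
    rw [LinearMap.mem_ker]
    apply Subtype.ext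
    change bind₁ q (f * p) = 0
    rw [map_mul, hfq, zero_mul]
  · rintro ⟨p, hp⟩ hpk
    have hpk' : bind₁ q p = 0 := congrArg Subtype.val (LinearMap.mem_ker.1 hpk)
    obtain ⟨g, rfl⟩ := hker _ p hp hpk'
    -- The cofactor `g` is not known to be homogeneous; replace it by a form of degree `n`.
    obtain ⟨A, hA, hAf⟩ := IsHomogeneous.exists_coeff_of_mem_span (p := fun _ : Fin 1 => f)
      (e := fun _ => δ) (fun _ => hf) hp (fun _ => by omega)
      (Ideal.mul_mem_right _ _ (Ideal.subset_span ⟨0, rfl⟩))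
    have hA0 := hA 0
    rw [Nat.add_sub_cancel_left] at hA0
    refine ⟨⟨A 0, hA0⟩, Subtype.ext ?_⟩
    change f * A 0 = f * g
    rw [hAf]
    simp [mul_comm]

end MvPolynomial

namespace ProjRatMap

variable {K : Type*} [Field K] {T : ProjSurface K} {Q : ProjRatMap K 3 4}

/-- If `Q` were constant, so would be `R ∘ Q`, which is nonzero and proportional to the variables.
-/
theorem IsBirationalOnto.degree_pos (hQ : Q.IsBirationalOnto T) : 0 < Q.degree := by
  obtain ⟨-, R, e, hR, ⟨i, hi⟩, hRX, -⟩ := hQ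
  by_contra! hd
  have hd0 : Q.degree = 0 := by omega
  have hconst : ∀ i, (bind₁ Q.coords (R i)).IsHomogeneous 0 := fun i => by
    have := IsHomogeneous.aeval (hR i) Q.coords Q.homogeneous
    rwa [hd0, zero_mul] at this
  obtain ⟨j, hj⟩ : ∃ j : Fin 3, j ≠ i := ⟨i + 1, by fin_cases i <;> simp⟩
  have h := hRX i j
  have hC : ∀ i, ∃ c, bind₁ Q.coords (R i) = C c := fun i =>
    ⟨_, totalDegree_eq_zero_iff_eq_C.1 ((totalDegree_zero_iff_isHomogeneous _).2 (hconst i))⟩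
  obtain ⟨a, ha⟩ := hC i
  obtain ⟨b, hb⟩ := hC j
  rw [ha] at hi
  rw [ha, hb] at h
  have h1 := congrArg (coeff (Finsupp.single j 1)) h
  rw [coeff_C_mul, coeff_C_mul, coeff_X, if_pos rfl, mul_one, coeff_X, if_neg, mul_zero] at h1
  · exact hi (by rw [h1, map_zero])
  · intro h2
    exact hj ((Finsupp.single_left_injective one_ne_zero h2).symm)

/-- A form vanishing on a parametrized surface is a multiple of the equation of the surface. -/
theorem IsBirationalOnto.dvd_of_bind₁_eq_zero (hQ : Q.IsBirationalOnto T) {n : ℕ}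
    {G : MvPolynomial (Fin 4) K} (hG : G.IsHomogeneous n) (hG0 : bind₁ Q.coords G = 0) :
    T.form ∣ G := by
  obtain ⟨-, R, e, hR, -, -, ⟨i, hi⟩, hXR⟩ := hQ
  have hprime : Prime T.form := T.irreducible.prime
  have hspan : (Ideal.span {T.form}).IsPrime := (Ideal.span_singleton_prime hprime.ne_zero).2 hprime
  let π : MvPolynomial (Fin 4) K →ₐ[K] MvPolynomial (Fin 4) K ⧸ Ideal.span {T.form} :=
    Ideal.Quotient.mkₐ K _
  have hπ : ∀ p, π p = 0 ↔ T.form ∣ p := fun p =>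
    Ideal.Quotient.eq_zero_iff_mem.trans Ideal.mem_span_singleton
  let h : Fin 4 → MvPolynomial (Fin 4) K ⧸ Ideal.span {T.form} := fun j => π (bind₁ R (Q.coords j))
  have hh : aeval h G = 0 := by
    have : aeval h G = π (bind₁ R (bind₁ Q.coords G)) := by
      rw [bind₁_bind₁, bind₁, comp_aeval_apply]
    rw [this, hG0, map_zero, map_zero]
  -- In the coordinate ring of `T`, a domain, `Q ∘ R` is proportional to the generic point;
  -- homogeneity carries the vanishing of `G` from one to the other.
  have hx : π (X i) • h = h i • fun j => π (X j) := by
    funext j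
    have := (hπ _).2 (hXR i j)
    rw [map_sub, map_mul, map_mul, sub_eq_zero] at this
    simp only [Pi.smul_apply, smul_eq_mul]
    rw [mul_comm]
    exact this.symm
  have h1 : h i ^ n * aeval (fun j => π (X j)) G = 0 := by
    rw [← hG.aeval_smul, ← hx, hG.aeval_smul, hh, mul_zero]
  have h2 : aeval (fun j => π (X j)) G = π G := by
    rw [← comp_aeval_apply, aeval_X_left_apply]
  rw [h2] at h1
  have h3 : h i ≠ 0 := fun h0 => hi ((hπ _).1 h0)
  exact (hπ G).1 ((mul_eq_zero.1 h1).resolve_left (pow_ne_zero _ h3))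

/-- The coordinate ring of the plane and that of the image of a birational parametrization without
base points agree up to a common denominator. -/
theorem IsBirationalOnto.exists_mul_eq_bind₁ [IsAlgClosed K] (hQ : Q.IsBirationalOnto T)
    (hbase : Q.baseLocus = ∅) :
    ∃ (h : MvPolynomial (Fin 3) K) (c : ℕ), h ≠ 0 ∧ ∀ (n : ℕ) (f : MvPolynomial (Fin 3) K),
      f.IsHomogeneous (Q.degree * n) →
        ∃ B : MvPolynomial (Fin 4) K, B.IsHomogeneous (n + c) ∧ bind₁ Q.coords B = h * f := by
  have hd := hQ.degree_pos
  obtain ⟨-, R, e, hR, ⟨i, hi⟩, hRX, -⟩ := hQ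
  obtain ⟨N, hN⟩ := exists_pow_idealOfVars_le (Ideal.span (Set.range Q.coords)) fun v hv =>
    eq_zero_of_baseLocus_eq_empty hbase fun i => hv _ (Ideal.subset_span ⟨i, rfl⟩)
  obtain ⟨k, hk⟩ : ∃ k, Q.coords k ≠ 0 := by
    by_contra! h0
    exact not_isUnit_zero (Q.coprime 0 fun i => by rw [h0 i])
  let r : Fin 3 → MvPolynomial (Fin 3) K := fun j => bind₁ Q.coords (R j)
  have hrX : (X i : MvPolynomial (Fin 3) K) • r = r i • X := by
    funext j
    simp only [Pi.smul_apply, smul_eq_mul]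
    rw [mul_comm]
    exact (hRX i j).symm
  have hswap : ∀ {n : ℕ} {f : MvPolynomial (Fin 3) K}, f.IsHomogeneous n →
      X i ^ n * bind₁ r f = r i ^ n * f := by
    intro n f hf
    have h1 := hf.aeval_smul (X i : MvPolynomial (Fin 3) K) r
    rw [hrX, hf.aeval_smul, aeval_X_left_apply] at h1
    exact h1.symm
  have hqr : bind₁ r (Q.coords k) ≠ 0 := by
    intro h0
    have h1 := hswap (Q.homogeneous k)
    rw [h0, mul_zero] at h1
    exact mul_ne_zero (pow_ne_zero _ hi) hk h1.symm
  -- Since `r` is `(r i / X i)` times `X`, a form of degree `Q.degree * n` is scaled by the `n`-th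
  -- power of the factor scaling `Q.coords k`.
  have hcross : ∀ {n : ℕ} {f : MvPolynomial (Fin 3) K}, f.IsHomogeneous (Q.degree * n) →
      bind₁ r (Q.coords k) ^ n * f = Q.coords k ^ n * bind₁ r f := by
    intro n f hf
    refine mul_left_cancel₀ (pow_ne_zero (Q.degree * n) (X_ne_zero (R := K) i)) ?_
    have h1 := hswap (Q.homogeneous k)
    have h2 := hswap hf
    calc X i ^ (Q.degree * n) * (bind₁ r (Q.coords k) ^ n * f)
        = (X i ^ Q.degree * bind₁ r (Q.coords k)) ^ n * f := by ring
      _ = Q.coords k ^ n * (r i ^ (Q.degree * n) * f) := by rw [h1]; ring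
      _ = _ := by rw [← h2]; ring
  have hbr : ∀ f, bind₁ Q.coords (bind₁ R f) = bind₁ r f := fun f => by rw [bind₁_bind₁]
  refine ⟨bind₁ r (Q.coords k) ^ N, Q.degree * e * N, pow_ne_zero _ hqr, fun n => ?_⟩
  have hRq : (bind₁ R (Q.coords k)).IsHomogeneous (e * Q.degree) :=
    IsHomogeneous.aeval (Q.homogeneous k) R hR
  have small : ∀ n ≤ N, ∀ f : MvPolynomial (Fin 3) K, f.IsHomogeneous (Q.degree * n) →
      ∃ B : MvPolynomial (Fin 4) K, B.IsHomogeneous (n + Q.degree * e * N) ∧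
        bind₁ Q.coords B = bind₁ r (Q.coords k) ^ N * f := by
    intro n hn f hf
    obtain ⟨l, rfl⟩ := Nat.exists_eq_add_of_le hn
    refine ⟨bind₁ R (Q.coords k) ^ l * (bind₁ R f * X k ^ n), ?_, ?_⟩
    · have h1 : (bind₁ R f).IsHomogeneous (e * (Q.degree * n)) := IsHomogeneous.aeval hf R hR
      have h2 := (hRq.pow l).mul (h1.mul (isHomogeneous_X_pow k n))
      convert h2 using 1
      ring
    · rw [map_mul, map_mul, map_pow, map_pow, hbr, hbr, bind₁_X_right, pow_add,
        mul_comm (bind₁ r f), ← hcross hf]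
      ring
  -- Beyond `N` the denominator stops growing: `f` is a combination of the `Q.coords j`, which are
  -- the images of `X j`, with coefficients of lower degree.
  induction n with
  | zero => exact small 0 (Nat.zero_le _)
  | succ n ih =>
    by_cases hn : n + 1 ≤ N
    · exact small _ hn
    · intro f hf
      have hmem : f ∈ Ideal.span (Set.range Q.coords) := by
        refine hN (Ideal.pow_le_pow_right ?_ hf.mem_pow_idealOfVars)
        exact (not_le.1 hn).le.trans (Nat.le_mul_of_pos_left _ hd)
      obtain ⟨A, hA, hAf⟩ := hf.exists_coeff_of_mem_span Q.homogeneous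
        (fun _ => Nat.le_mul_of_pos_right _ (Nat.succ_pos n)) hmem
      have hsub : Q.degree * (n + 1) - Q.degree = Q.degree * n := by
        rw [mul_add, mul_one, Nat.add_sub_cancel]
      simp only [hsub] at hA
      choose B hB hBA using fun j => ih (A j) (hA j)
      refine ⟨∑ j, B j * X j, IsHomogeneous.sum _ _ _ fun j _ => ?_, ?_⟩
      · have h1 := (hB j).mul (isHomogeneous_X K j)
        convert h1 using 1
        ring
      · rw [map_sum, hAf, Finset.mul_sum]
        refine Finset.sum_congr rfl fun j _ => ?_
        rw [map_mul, hBA, bind₁_X_right]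
        ring

theorem six_mul_choose_three (n : ℕ) : 6 * (4 + n - 1).choose n = (n + 1) * (n + 2) * (n + 3) := by
  have h1 : 4 + n - 1 = n + 3 := by omega
  have h2 := Nat.add_choose_mul_factorial_mul_factorial n 3
  have h3 : (n + 3).factorial = (n + 1) * (n + 2) * (n + 3) * n.factorial := by
    simp only [Nat.factorial_succ]; ring
  rw [h3, show Nat.factorial 3 = 6 from rfl] at h2
  rw [h1]
  have h4 := Nat.choose_symm_add (a := n) (b := 3)
  refine Nat.eq_of_mul_eq_mul_right n.factorial_pos ?_
  rw [h4]
  linarith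

theorem two_mul_choose_two (n : ℕ) : 2 * (3 + n - 1).choose n = (n + 1) * (n + 2) := by
  have h1 : 3 + n - 1 = n + 2 := by omega
  have h2 := Nat.add_choose_mul_factorial_mul_factorial n 2
  have h3 : (n + 2).factorial = (n + 1) * (n + 2) * n.factorial := by
    simp only [Nat.factorial_succ]; ring
  rw [h3, show Nat.factorial 2 = 2 from rfl] at h2
  rw [h1]
  have h4 := Nat.choose_symm_add (a := n) (b := 2)
  refine Nat.eq_of_mul_eq_mul_right n.factorial_pos ?_
  rw [h4]
  linarith

/-- The degree of a surface with a birational parametrization without base points. -/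
theorem IsBirationalOnto.degree_eq [IsAlgClosed K] (hQ : Q.IsBirationalOnto T)
    (hbase : Q.baseLocus = ∅) : T.degree = Q.degree ^ 2 := by
  set d := Q.degree with hd
  set δ := T.degree with hδ
  have hsum := fun n =>
    finrank_range_substForms_add Q.homogeneous T.homogeneous T.irreducible.ne_zero
    hQ.1 (fun n p hp => hQ.dvd_of_bind₁_eq_zero hp) n
  have hupper : ∀ n, Module.finrank K (LinearMap.range (substForms Q.homogeneous n)) ≤
      (3 + d * n - 1).choose (d * n) := by
    intro n
    rw [← finrank_homogeneousSubmodule K]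
    exact Submodule.finrank_le _
  obtain ⟨h, c, hh0, hh⟩ := hQ.exists_mul_eq_bind₁ hbase
  -- Multiplication by `h` embeds the plane forms of degree `d * n` into the image in degree `n +
  -- c`.
  have hlower : ∀ n, (3 + d * n - 1).choose (d * n) ≤
      Module.finrank K (LinearMap.range (substForms Q.homogeneous (n + c))) := by
    intro n
    rw [← finrank_homogeneousSubmodule K]
    have hmem : ∀ f : homogeneousSubmodule (Fin 3) K (d * n),
        ∃ B : LinearMap.range (substForms Q.homogeneous (n + c)),
          (B : MvPolynomial (Fin 3) K) = h * f := by
      intro f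
      obtain ⟨B, hB, hBf⟩ := hh n f f.2
      exact ⟨⟨substForms Q.homogeneous (n + c) ⟨B, hB⟩, ⟨_, rfl⟩⟩, hBf⟩
    choose φ hφ using hmem
    let Φ : homogeneousSubmodule (Fin 3) K (d * n) →ₗ[K]
        LinearMap.range (substForms Q.homogeneous (n + c)) :=
      { toFun := φ
        map_add' := fun a b => by
          apply Subtype.ext; apply Subtype.ext
          change ((φ (a + b) : _) : MvPolynomial (Fin 3) K) = (φ a : MvPolynomial (Fin 3) K) + φ b
          rw [hφ, hφ, hφ, ← mul_add]; rfl
        map_smul' := fun a b => by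
          apply Subtype.ext; apply Subtype.ext
          change ((φ (a • b) : _) : MvPolynomial (Fin 3) K) = a • (φ b : MvPolynomial (Fin 3) K)
          rw [hφ, hφ, ← mul_smul_comm]; rfl }
    refine LinearMap.finrank_le_finrank_of_injective (f := Φ) fun a b hab => ?_
    have h1 : (φ a : MvPolynomial (Fin 3) K) = φ b := by
      have : φ a = φ b := hab
      rw [this]
    rw [hφ, hφ] at h1
    exact Subtype.ext (mul_left_cancel₀ hh0 h1)
  apply le_antisymm
  · have h3 : 3 * δ ≤ 3 * d ^ 2 := by
      -- All counts are multiplied by six; the constants come from `3 * (d * (δ + n) + 1) * (d * (δ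
      -- + n) + 2)`.
      apply Nat.le_of_forall_quadratic_le (c := 6 * d ^ 2 * δ + 9 * d)
        (e := 3 * d ^ 2 * δ ^ 2 + 9 * d * δ + 6)
      intro n
      have e1 := hsum n
      have e2 := hupper (δ + n)
      have e3 := six_mul_choose_three n
      have e4 := six_mul_choose_three (δ + n)
      have e5 := two_mul_choose_two (d * (δ + n))
      change _ + _ = (4 + (δ + n) - 1).choose (δ + n) at e1
      change Module.finrank K (LinearMap.range (substForms Q.homogeneous (δ + n))) + _ = _ at e1
      have e6 : (δ + n + 1) * (δ + n + 2) * (δ + n + 3) ≤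
          (n + 1) * (n + 2) * (n + 3) +
            3 * ((d * (δ + n) + 1) * (d * (δ + n) + 2)) := by
        rw [← e3, ← e4, ← e5, ← e1]
        linarith
      have e7 : 3 * δ * n ^ 2 + (n + 1) * (n + 2) * (n + 3) ≤
          (δ + n + 1) * (δ + n + 2) * (δ + n + 3) := by
        ring_nf
        have : 0 ≤ δ * n * 12 + δ * 11 + δ ^ 2 * n * 3 + δ ^ 2 * 6 + δ ^ 3 := Nat.zero_le _
        linarith
      have e8 : 3 * ((d * (δ + n) + 1) * (d * (δ + n) + 2)) =
          3 * d ^ 2 * n ^ 2 + (6 * d ^ 2 * δ + 9 * d) * n +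
            (3 * d ^ 2 * δ ^ 2 + 9 * d * δ + 6) := by ring
      linarith
    linarith
  · have h3 : 3 * d ^ 2 ≤ 3 * δ := by
      -- These are the lower coefficients in `n` of six times the Hilbert function of `T` in degree
      -- `δ + n + c`.
      apply Nat.le_of_forall_quadratic_le (c := 6 * δ * c + 3 * δ ^ 2 + 12 * δ)
        (e := 3 * δ * c ^ 2 + (3 * δ ^ 2 + 12 * δ) * c + δ ^ 3 + 6 * δ ^ 2 + 11 * δ)
      intro n
      have e1 := hsum (n + c)
      have e2 := hlower (δ + n)
      have e3 := six_mul_choose_three (n + c)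
      have e4 := six_mul_choose_three (δ + (n + c))
      have e5 := two_mul_choose_two (d * (δ + n))
      change Module.finrank K (LinearMap.range (substForms Q.homogeneous (δ + (n + c)))) + _ =
        (4 + (δ + (n + c)) - 1).choose (δ + (n + c)) at e1
      rw [add_assoc δ n c] at e2
      have e6 : 3 * ((d * (δ + n) + 1) * (d * (δ + n) + 2)) +
          (n + c + 1) * (n + c + 2) * (n + c + 3) ≤
          (δ + (n + c) + 1) * (δ + (n + c) + 2) * (δ + (n + c) + 3) := by
        rw [← e3, ← e4, ← e5, ← e1]
        linarith
      have e7 : (δ + (n + c) + 1) * (δ + (n + c) + 2) * (δ + (n + c) + 3) =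
          (n + c + 1) * (n + c + 2) * (n + c + 3) + (3 * δ * n ^ 2 +
            (6 * δ * c + 3 * δ ^ 2 + 12 * δ) * n +
            (3 * δ * c ^ 2 + (3 * δ ^ 2 + 12 * δ) * c + δ ^ 3 + 6 * δ ^ 2 + 11 * δ)) := by
        ring
      have e8 : 3 * d ^ 2 * n ^ 2 ≤ 3 * ((d * (δ + n) + 1) * (d * (δ + n) + 2)) := by
        have : 3 * ((d * (δ + n) + 1) * (d * (δ + n) + 2)) = 3 * d ^ 2 * n ^ 2 +
          ((6 * d ^ 2 * δ + 9 * d) * n + (3 * d ^ 2 * δ ^ 2 + 9 * d * δ + 6)) := by ring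
        rw [this]
        exact Nat.le_add_right _ _
      linarith
    linarith

end ProjRatMap

/-! ### Composites and the conclusion -/

namespace ProjRatMap

variable {K : Type*} [Field K]

/-- A composite with a map without base points is, up to a constant, given by substituting the
forms. -/
theorem exists_coords_eq_of_compEq [IsAlgClosed K] {n m l : ℕ} {g : ProjRatMap K m l}
    {f : ProjRatMap K n m} {h : ProjRatMap K n l} (hcomp : g.CompEq f h)
    (hbase : g.baseLocus = ∅) :
    ∃ c : K, c ≠ 0 ∧ ∀ i, h.coords i = bind₁ f.coords (C c * g.coords i) := by
  obtain ⟨N, hN⟩ := exists_pow_idealOfVars_le (Ideal.span (Set.range g.coords)) fun v hv =>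
    eq_zero_of_baseLocus_eq_empty hbase fun i => hv _ (Ideal.subset_span ⟨i, rfl⟩)
  -- The forms of `g` generate a power of the ideal of the variables, so a common factor of the
  -- composite divides a power of every `f.coords j`.
  have hcop : ∀ p, (∀ i, p ∣ bind₁ f.coords (g.coords i)) → IsUnit p := by
    intro p hp
    have hpow : ∀ j, p ∣ f.coords j ^ N := by
      intro j
      have h1 : Ideal.span (Set.range g.coords) ≤
          Ideal.comap (bind₁ f.coords) (Ideal.span {p}) := by
        rw [Ideal.span_le]
        rintro _ ⟨i, rfl⟩
        exact Ideal.mem_span_singleton.2 (hp i)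
      have h2 := h1 (hN (Ideal.pow_mem_pow (Ideal.subset_span (Set.mem_range_self j)) N))
      rw [Ideal.mem_comap, map_pow, bind₁_X_right] at h2
      exact Ideal.mem_span_singleton.1 h2
    by_contra hu
    by_cases hp0 : p = 0
    · refine not_isUnit_zero (f.coprime 0 fun j => ?_)
      have h1 := hpow j
      rw [hp0, zero_dvd_iff] at h1
      rw [eq_zero_of_pow_eq_zero h1]
    · obtain ⟨e, he, hep⟩ := WfDvdMonoid.exists_irreducible_factor hu hp0
      exact he.not_isUnit (f.coprime e fun j => he.prime.dvd_of_dvd_pow (hep.trans (hpow j)))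
  obtain ⟨c, hc, hceq⟩ := exists_unit_mul_eq_of_proportional h.coprime hcop hcomp.1 hcomp.2
  obtain ⟨a, ha, rfl⟩ := MvPolynomial.isUnit_iff_eq_C_of_isReduced.1 hc
  refine ⟨a, ha.ne_zero, fun i => ?_⟩
  rw [hceq, map_mul, bind₁_C_right]

end ProjRatMap

theorem mainTheorem11 {K : Type*} [Field K] [IsAlgClosed K] [CharZero K]
    (T : ProjSurface K) (P Q : ProjRatMap K 3 4) (S : ProjRatMap K 3 3)
    (hQ : Q.IsBirationalOnto T) (hcomp : Q.CompEq S P) (hbase : Q.baseLocus = ∅) :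
    S.baseLocus = P.baseLocus ∧
      ∀ A ∈ S.baseLocus,
        PlaneCurve.mult (Generic.point A) (Generic.W₁ P) =
            PlaneCurve.mult (Generic.point A) (Generic.V₁ S) * (Q.degree : ℕ∞) ∧
          Generic.baseMultS S A ≠ ⊤ ∧
          (T.degree : ℕ∞) * Generic.baseMultS S A = Generic.baseMultP P A := by
  have hd := hQ.degree_pos
  obtain ⟨c, hc0, hP⟩ := ProjRatMap.exists_coords_eq_of_compEq hcomp hbase
  have hq : ∀ i, (C c * Q.coords i).IsHomogeneous Q.degree := fun i => (Q.homogeneous i).C_mul c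
  have hqbase : ∀ v : Fin 3 → K, (∀ i, eval v (C c * Q.coords i) = 0) → v = 0 := fun v hv =>
    ProjRatMap.eq_zero_of_baseLocus_eq_empty hbase fun i => by
      simpa [hc0] using hv i
  -- The curves `V₁, V₂` are the case of the identity map, with forms `X i` and degree one.
  have hXbase : ∀ v : Fin 3 → K, (∀ i, eval v (X i : MvPolynomial (Fin 3) K) = 0) → v = 0 :=
    fun v hv => funext fun i => by simpa using hv i
  have hS : S.coords = fun i => bind₁ S.coords (X i) := funext fun i => (bind₁_X_right _ _).symm
  have hP' : P.coords = fun i => bind₁ S.coords (C c * Q.coords i) := funext hP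
  have hxy := Generic.algebraicIndependent_xy K
  have hxy' : AlgebraicIndependent K (Sum.elim (fun i : Fin 3 => Generic.x K i.castSucc)
      (fun i : Fin 3 => Generic.y K i.castSucc)) := by
    have h1 := hxy.comp (Sum.map Fin.castSucc Fin.castSucc)
      (Sum.map_injective.2 ⟨Fin.castSucc_injective 3, Fin.castSucc_injective 3⟩)
    rwa [Sum.elim_comp_map] at h1
  have hevalP : ∀ v i, eval v (P.coords i) =
      eval (fun j => eval v (S.coords j)) (C c * Q.coords i) := fun v i => by
    rw [hP]
    exact eval₂Hom_bind₁ _ _ _ _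
  refine ⟨?_, fun A hA => ?_⟩
  · ext A
    constructor
    · intro hA i
      have h0 : (fun j => eval A.rep (S.coords j)) = 0 := funext hA
      rw [hevalP, h0]
      have h1 := (hq i).aeval_smul (0 : K) 0
      rw [zero_pow hd.ne', zero_mul, zero_smul] at h1
      exact h1
    · intro hA j
      exact congrFun (hqbase _ fun i => by rw [← hevalP]; exact hA i) j
  · have hlin : LinearIndependent K (Generic.x K) :=
      (hxy.comp Sum.inl Sum.inl_injective).linearIndependent
    have hlin' : LinearIndependent K (fun i : Fin 3 => Generic.x K i.castSucc) :=
      hlin.comp _ (Fin.castSucc_injective 3)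
    have hW : Generic.member (Generic.x K) (fun i => bind₁ S.coords (C c * Q.coords i)) =
        Generic.W₁ P := by rw [← hP']; rfl
    have hW' : Generic.member (Generic.y K) (fun i => bind₁ S.coords (C c * Q.coords i)) =
        Generic.W₂ P := by rw [← hP']; rfl
    have hV : Generic.member (fun i : Fin 3 => Generic.x K i.castSucc)
        (fun i => bind₁ S.coords (X i)) = Generic.V₁ S := by rw [← hS]; rfl
    have hV' : Generic.member (fun i : Fin 3 => Generic.y K i.castSucc)
        (fun i => bind₁ S.coords (X i)) = Generic.V₂ S := by rw [← hS]; rfl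
    obtain ⟨regW, finW, leW, s, hs⟩ :=
      Generic.isRegularPair_member hd hA hq hqbase hxy rfl (by rw [hW]) (by rw [hW'])
    obtain ⟨regV, finV, leV, r, hr⟩ :=
      Generic.isRegularPair_member one_pos hA (fun i => isHomogeneous_X K i) hXbase hxy' rfl
        (by rw [hV]) (by rw [hV'])
    refine ⟨?_, finV, ?_⟩
    · rw [← hW]
      exact Generic.mult_member_eq hd A hq hqbase hlin hlin'
    · rw [hQ.degree_eq hbase]
      exact (regV.length_eq_of_reduction _ regW finV finW (by rwa [pow_one] at leV) leW hr hs).symm
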